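/- Fix integers $s\ge 1$, $t\ge 0$ and $q\ge 0$. An instance consists of positive integers $n_1,\dots,n_s$ and vectors $a^{p,j}\in\mathbb Q^{n_j}$ for $p\in[q]$, $j\in[s]$. They define the $n_1\times\cdots\times n_s$ tensor $A=\sum_{p\in[q]} a^{p,1}\otimes\cdots\otimes a^{p,s}$, where $\otimes$ is the vector outer product; so a factorization of the input tensor $A$ into $q$ terms is given. The rank of a tensor is the minimum number of terms in such a factorization over $\mathbb Q$. The binary rank of a tensor is the minimum $r$ such that it can be written as $\sum_{i\in[r]} c^{i,1}\otimes\cdots\otimes c^{i,s}$ with $c^{i,j}\in\{0,1\}^{n_j}$ (tensors without such a representation have no finite binary rank). The rank-$t$ binary tensor factorization problem asks for an $n_1\times\cdots\times n_s$ tensor $B=(b_{k_1,\dots,k_s})$ of binary rank $t$ that minimizes $$\sum_{k_1\in[n_1]}\cdots\sum_{k_s\in[n_s]}\bigl(a_{k_1,\dots,k_s}-b_{k_1,\dots,k_s}\bigr)^2 .$$ The solution $B$ is returned through vectors $x^{i,j}\in\{0,1\}^{n_j}$, $i\in[t]$, $j\in[s]$, with $B=\sum_{i\in[t]}x^{i,1}\otimes\cdots\otimes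 x^{i,s}$. Claim. The rank-$t$ binary tensor factorization problem can be solved in strongly polynomial time: there are an algorithm and a polynomial $P$, both depending only on $s,t,q$, such that on each instance the algorithm returns an optimal solution after at most $P(n_1+\cdots+n_s)$ steps (additions, subtractions, multiplications, divisions and comparisons of rational numbers, and elementary operations on natural numbers used as indices, the latter all being at most $P(n_1+\cdots+n_s)$), and every rational number produced during the execution has at most $P(L)$ bits, where $L$ is the bit size of the input (the sum of $n_1+\cdots+n_s$ and of the bit sizes of all the entries of the $a^{p,j}$). This holds both if $B$ is required to have binary rank exactly $t$ and if $B$ is required to have binary rank at most $t$. In particular, both versions of the problem can be solved in strongly polynomial time on the instances in which the rank of $A$ equals the fixed number $q$, i.e. in which the input tensor has fixed rank $q$ and a rank factorization is given. -/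

import Mathlib

/-! ## Rational random access machines, as structured programs with a step count

A machine has a bank of index registers and index arrays holding natural numbers (used for
loop control and addressing) and a bank of arrays holding rational numbers. Rational numbers can
only be moved, combined by the four elementary arithmetic operations, and compared; they never
flow into the index bank. -/

namespace StronglyPoly

/-- Memory: index registers `reg r`, index arrays `tab A` and rational arrays `arr A`, each array
having cells numbered by the natural numbers. -/
structure Mem where
  reg : ℕ → ℕ
  tab : ℕ → ℕ → ℕ
  arr : ℕ → ℕ → ℚ

/-- Operations on indices (`sub` is truncated subtraction). -/
inductive IdxOp where
  | add
  | sub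
  | mul

def IdxOp.eval : IdxOp → ℕ → ℕ → ℕ
  | .add, a, b => a + b
  | .sub, a, b => a - b
  | .mul, a, b => a * b

/-- The elementary arithmetic operations on rational numbers. -/
inductive RatOp where
  | add
  | sub
  | mul
  | div

def RatOp.eval : RatOp → ℚ → ℚ → ℚ
  | .add, a, b => a + b
  | .sub, a, b => a - b
  | .mul, a, b => a * b
  | .div, a, b => a / b

/-- Elementary instructions. In a rational operand `(A, i)` the array `A` is fixed in the program
and the position is the current content of index register `i`. -/
inductive Instr where
  /-- `reg r := c` -/
  | idxConst (r c : ℕ)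
  /-- `reg r := reg a o reg b` -/
  | idxOp (o : IdxOp) (r a b : ℕ)
  /-- `reg r := tab A [reg i]` -/
  | idxLoad (r A i : ℕ)
  /-- `tab A [reg i] := reg r` -/
  | idxStore (A i r : ℕ)
  /-- `arr A [reg i] := c` -/
  | ratConst (A i : ℕ) (c : ℚ)
  /-- `arr D [reg d] := arr A [reg a]` -/
  | ratMove (D d A a : ℕ)
  /-- `arr D [reg d] := arr A [reg a] o arr B [reg b]` -/
  | ratOp (o : RatOp) (D d A a B b : ℕ)

def Mem.setReg (σ : Mem) (r v : ℕ) : Mem :=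
  { σ with reg := Function.update σ.reg r v }

def Mem.setTab (σ : Mem) (A k v : ℕ) : Mem :=
  { σ with tab := Function.update σ.tab A (Function.update (σ.tab A) k v) }

def Mem.setArr (σ : Mem) (A k : ℕ) (v : ℚ) : Mem :=
  { σ with arr := Function.update σ.arr A (Function.update (σ.arr A) k v) }

/-- Number of bits of a rational number: one for the sign, plus the bits of numerator and
denominator. -/
def ratSize (x : ℚ) : ℕ := 1 + Nat.size x.num.natAbs + Nat.size x.den

/-- `Step W L i σ σ'`: the instruction `i` leads from memory `σ` to memory `σ'`, where the number
that it writes is at most `W` if it is an index, and has at most `L` bits if it is rational.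
Division by zero is not executable. -/
inductive Step (W L : ℕ) : Instr → Mem → Mem → Prop
  | idxConst (σ : Mem) (r c : ℕ) (h : c ≤ W) :
      Step W L (.idxConst r c) σ (σ.setReg r c)
  | idxOp (σ : Mem) (o : IdxOp) (r a b : ℕ) (h : o.eval (σ.reg a) (σ.reg b) ≤ W) :
      Step W L (.idxOp o r a b) σ (σ.setReg r (o.eval (σ.reg a) (σ.reg b)))
  | idxLoad (σ : Mem) (r A i : ℕ) (h : σ.tab A (σ.reg i) ≤ W) :
      Step W L (.idxLoad r A i) σ (σ.setReg r (σ.tab A (σ.reg i)))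
  | idxStore (σ : Mem) (A i r : ℕ) (h : σ.reg r ≤ W) :
      Step W L (.idxStore A i r) σ (σ.setTab A (σ.reg i) (σ.reg r))
  | ratConst (σ : Mem) (A i : ℕ) (c : ℚ) (h : ratSize c ≤ L) :
      Step W L (.ratConst A i c) σ (σ.setArr A (σ.reg i) c)
  | ratMove (σ : Mem) (D d A a : ℕ) (h : ratSize (σ.arr A (σ.reg a)) ≤ L) :
      Step W L (.ratMove D d A a) σ (σ.setArr D (σ.reg d) (σ.arr A (σ.reg a)))
  | ratOp (σ : Mem) (o : RatOp) (D d A a B b : ℕ)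
      (h0 : o = RatOp.div → σ.arr B (σ.reg b) ≠ 0)
      (h : ratSize (o.eval (σ.arr A (σ.reg a)) (σ.arr B (σ.reg b))) ≤ L) :
      Step W L (.ratOp o D d A a B b) σ
        (σ.setArr D (σ.reg d) (o.eval (σ.arr A (σ.reg a)) (σ.arr B (σ.reg b))))

/-- Tests: comparison of two index registers, or of two rational cells. -/
inductive Test where
  /-- `reg a < reg b` -/
  | idxLt (a b : ℕ)
  /-- `arr A [reg a] < arr B [reg b]` -/
  | ratLt (A a B b : ℕ)

def Test.Holds : Test → Mem → Prop
  | .idxLt a b, σ => σ.reg a < σ.reg b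
  | .ratLt A a B b, σ => σ.arr A (σ.reg a) < σ.arr B (σ.reg b)

/-- Programs. -/
inductive Prog where
  | skip
  | instr (i : Instr)
  | seq (c d : Prog)
  | ite (b : Test) (c d : Prog)
  | loop (b : Test) (c : Prog)

/-- `Run W L c σ T σ'`: started in memory `σ`, the program `c` halts in memory `σ'` after exactly
`T` steps (each instruction and each evaluation of a test is one step), and all indices written
on the way are at most `W`, all rational numbers written on the way have at most `L` bits. -/
inductive Run (W L : ℕ) : Prog → Mem → ℕ → Mem → Prop
  | skip (σ : Mem) : Run W L .skip σ 1 σ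
  | instr {i : Instr} {σ σ' : Mem} (h : Step W L i σ σ') : Run W L (.instr i) σ 1 σ'
  | seq {c d : Prog} {σ σ' σ'' : Mem} {T U : ℕ}
      (hc : Run W L c σ T σ') (hd : Run W L d σ' U σ'') : Run W L (.seq c d) σ (T + U) σ''
  | ite_true {b : Test} {c d : Prog} {σ σ' : Mem} {T : ℕ}
      (hb : b.Holds σ) (hc : Run W L c σ T σ') : Run W L (.ite b c d) σ (1 + T) σ'
  | ite_false {b : Test} {c d : Prog} {σ σ' : Mem} {T : ℕ}
      (hb : ¬ b.Holds σ) (hd : Run W L d σ T σ') : Run W L (.ite b c d) σ (1 + T) σ'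
  | loop_false {b : Test} {c : Prog} {σ : Mem}
      (hb : ¬ b.Holds σ) : Run W L (.loop b c) σ 1 σ
  | loop_true {b : Test} {c : Prog} {σ σ' σ'' : Mem} {T U : ℕ}
      (hb : b.Holds σ) (hc : Run W L c σ T σ') (hw : Run W L (.loop b c) σ' U σ'') :
      Run W L (.loop b c) σ (1 + T + U) σ''

/-- A computational problem with instances `x : ι`, whose input consists of (up to a constant
factor) `dim x` numbers of total bit size `size x` and is stored as the memory `input x`, is
solvable in strongly polynomial time if one program solves all instances, where the number of
steps and all index values are bounded by a polynomial in `dim x`, and the bit size of each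
rational number produced during the execution is bounded by a polynomial in `size x`.
`correct x σ` says that the final memory `σ` holds a solution of the instance `x`. -/
def Solvable {ι : Type*} (dim size : ι → ℕ) (input : ι → Mem) (correct : ι → Mem → Prop) : Prop :=
  ∃ (c : Prog) (P : Polynomial ℕ), ∀ x : ι, ∃ (T : ℕ) (σ : Mem),
    Run (P.eval (dim x)) (P.eval (size x)) c (input x) T σ ∧ T ≤ P.eval (dim x) ∧ correct x σ

end StronglyPoly

/-! ## Tensors -/

namespace BTF

/-- Rational tensors of order `s` and format `n 0 × ⋯ × n (s-1)`. -/
abbrev Tensor {s : ℕ} (n : Fin s → ℕ) : Type := (∀ j : Fin s, Fin (n j)) → ℚ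

/-- A family of `s` rational vectors, one of each dimension `n j`. -/
abbrev Vectors {s : ℕ} (n : Fin s → ℕ) : Type := ∀ j : Fin s, Fin (n j) → ℚ

/-- The outer product `c 0 ⊗ ⋯ ⊗ c (s-1)`. -/
def outer {s : ℕ} {n : Fin s → ℕ} (c : Vectors n) : Tensor n :=
  fun k => ∏ j, c j (k j)

/-- The vectors have entries in `{0, 1}`. -/
def IsBinary {s : ℕ} {n : Fin s → ℕ} (c : Vectors n) : Prop :=
  ∀ j k, c j k = 0 ∨ c j k = 1

/-- `r` is the rank of `C`. -/
def HasRank {s : ℕ} {n : Fin s → ℕ} (C : Tensor n) (r : ℕ) : Prop :=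
  IsLeast {m : ℕ | ∃ c : Fin m → Vectors n, C = ∑ i, outer (c i)} r

/-- `r` is the binary rank of `C`. -/
def HasBinaryRank {s : ℕ} {n : Fin s → ℕ} (C : Tensor n) (r : ℕ) : Prop :=
  IsLeast {m : ℕ | ∃ c : Fin m → Vectors n, (∀ i, IsBinary (c i)) ∧ C = ∑ i, outer (c i)} r

/-- The objective function: sum of the squared differences of the entries. -/
def sqDist {s : ℕ} {n : Fin s → ℕ} (A B : Tensor n) : ℚ :=
  ∑ k, (A k - B k) ^ 2

/-- `B` minimizes the objective function for `A` over all tensors satisfying `feasible`. -/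
def IsBest {s : ℕ} {n : Fin s → ℕ} (feasible : Tensor n → Prop) (A B : Tensor n) : Prop :=
  feasible B ∧ ∀ B' : Tensor n, feasible B' → sqDist A B ≤ sqDist A B'

/-- An instance: a tensor of order `s`, given by `q` families of vectors whose outer products
sum to it. -/
structure Inst (s q : ℕ) where
  n : Fin s → ℕ
  n_pos : ∀ j, 0 < n j
  a : Fin q → Vectors n

variable {s q : ℕ}

/-- The input tensor. -/
def Inst.tensor (I : Inst s q) : Tensor I.n := ∑ p, outer (I.a p)

/-- The number of entries of the vectors of one term. For fixed `s` and `q`, the input consists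
of `s + q * dim` numbers. -/
def Inst.dim (I : Inst s q) : ℕ := ∑ j, I.n j

/-- The bit size of the input. -/
def Inst.size (I : Inst s q) : ℕ :=
  I.dim + ∑ p, ∑ j, ∑ k, StronglyPoly.ratSize (I.a p j k)

/-- The memory holding the input: register `j` contains `n j`, the rational array `p * s + j`
contains the vector `a p j`, everything else is zero. -/
def Inst.input (I : Inst s q) : StronglyPoly.Mem where
  reg := fun j => if h : j < s then I.n ⟨j, h⟩ else 0
  tab := fun _ _ => 0
  arr := fun m k =>
    if h : m / s < q ∧ m % s < s then
      if hk : k < I.n ⟨m % s, h.2⟩ then I.a ⟨m / s, h.1⟩ ⟨m % s, h.2⟩ ⟨k, hk⟩ else 0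
    else 0

/-- The `t` families of vectors held by a memory as output: the `j`-th vector of the `i`-th family
is contained in the rational array `i * s + j`. -/
def output (n : Fin s → ℕ) (t : ℕ) (σ : StronglyPoly.Mem) : Fin t → Vectors n :=
  fun i j k => σ.arr (i * s + j) k

/-- The final memory holds binary vectors `x i j`, for `i < t` and `j < s`, such that
`∑ i, x i 0 ⊗ ⋯ ⊗ x i (s-1)` is a best approximation of the input tensor among the
tensors whose binary rank satisfies `rk`. -/
def Correct (t : ℕ) (rk : ℕ → Prop) (I : Inst s q) (σ : StronglyPoly.Mem) : Prop :=
  (∀ i, IsBinary (output I.n t σ i)) ∧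
    IsBest (fun B => ∃ r, HasBinaryRank B r ∧ rk r) I.tensor (∑ i, outer (output I.n t σ i))

/-- Strongly polynomial solvability, for fixed `s`, `t` and `q`, of the binary tensor factorization
problem with binary rank constraint `rk`, on the instances satisfying `adm`. -/
def StronglyPolySolvable (s t q : ℕ) (rk : ℕ → Prop) (adm : Inst s q → Prop) : Prop :=
  StronglyPoly.Solvable (ι := {I : Inst s q // adm I})
    (fun I => I.1.dim) (fun I => I.1.size) (fun I => I.1.input) (fun I σ => Correct t rk I.1 σ)

end BTF

/-! Arrange the binary vectors of factor j as an n_j × t matrix. Each row is one of the 2^t types in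
{0,1}^t. With the other factors fixed, the objective is a sum over the rows of factor j
(`sqDist_update`), and the difference of the costs of two types is an affine function of the input
row in ℚ^q (`rowCost_sub`). A cheapest type for every row can therefore be read off from the signs
of 4^t affine functions at n_j points. Such a sign pattern is determined by q+1 pivot points and q+1
signs (`exists_pat`), which leaves polynomially many possibilities when t and q are fixed.

The rank constraint is controlled by the set of types in use: copying and deleting slices cannot
raise the binary rank, so the rank can only grow when more types occur (`binaryRank_le`). If one
representative row is kept for each type of the old factor, reoptimizing that factor preserves
feasibility, for rank exactly t as well as at most t. Reoptimizing the factors of an optimal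
solution one after another yields an optimal solution in which each factor is described by boundedly
many indices below dim + 3 (`exists_optimal_cand`). The description of a factor refers only to the
input rows of that factor, never to the unknown optimum, so all descriptions can be enumerated.

The algorithm tries all of them. For each it sums the objective over all positions, records which
types occur, decides feasibility by a finite table built into the program, and keeps the best
candidate.

For the bit bound, every value kept in an array that the algorithm maintains is an input entry, a
small integer or a partial sum of the objective, and it is computed by an expression whose size
depends only on s, t, q. Heights grow linearly in such an evaluation (`Expr.ht_eval_le`) and
linearly in the number of summands (`ht_listSum_le`). Programs are verified through two
constructions, simultaneous assignment (`exists_assign`) and nested counting loops (`triple_nest`).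
-/

namespace StronglyPoly

/-! ### Heights of rational numbers -/

/-- The number of bits of the larger one of numerator and denominator. -/
def ht (x : ℚ) : ℕ := Nat.size (max x.num.natAbs x.den)

theorem ratSize_le_ht (x : ℚ) : ratSize x ≤ 2 * ht x + 1 := by
  have h1 : Nat.size x.num.natAbs ≤ ht x := Nat.size_le_size (le_max_left _ _)
  have h2 : Nat.size x.den ≤ ht x := Nat.size_le_size (le_max_right _ _)
  unfold ratSize
  omega

theorem ht_le_ratSize (x : ℚ) : ht x ≤ ratSize x := by
  unfold ht ratSize
  rcases max_choice x.num.natAbs x.den with h | h <;> rw [h] <;> omega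

/-- Cancellation only replaces numerator and denominator by divisors, so heights may be estimated on
unreduced fractions. -/
theorem ht_divInt_le (a b : ℤ) (hb : b ≠ 0) {n : ℕ} (ha : a.natAbs < 2 ^ n)
    (hb' : b.natAbs < 2 ^ n) : ht (Rat.divInt a b) ≤ n := by
  unfold ht
  rw [Nat.size_le, max_lt_iff]
  constructor
  · rcases eq_or_ne a 0 with rfl | h0
    · simp
    · exact lt_of_le_of_lt
        (Nat.le_of_dvd (Int.natAbs_pos.2 h0) (Int.natAbs_dvd_natAbs.2 (Rat.num_dvd a hb))) ha
  · refine lt_of_le_of_lt (Nat.le_of_dvd (Int.natAbs_pos.2 hb) ?_) hb'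
    have := Int.natAbs_dvd_natAbs.2 (Rat.den_dvd a b)
    simpa using this

theorem num_lt_two_pow_ht (x : ℚ) : x.num.natAbs < 2 ^ ht x :=
  Nat.size_le.1 (Nat.size_le_size (le_max_left _ _))

theorem den_lt_two_pow_ht (x : ℚ) : x.den < 2 ^ ht x :=
  Nat.size_le.1 (Nat.size_le_size (le_max_right _ _))

/-- Measuring the larger of numerator and denominator, rather than their total size, makes the bound
additive up to 1. This keeps long sums linear in the number of terms. -/
theorem ht_add_le (x y : ℚ) : ht (x + y) ≤ ht x + ht y + 1 := by
  have h1 := num_lt_two_pow_ht x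
  have h2 := num_lt_two_pow_ht y
  have h3 := den_lt_two_pow_ht x
  have h4 := den_lt_two_pow_ht y
  have e : x + y = Rat.divInt (x.num * y.den + y.num * x.den) (x.den * y.den) := by
    rw [Rat.divInt_eq_div]
    have hx : (x.den : ℚ) ≠ 0 := by exact_mod_cast x.den_ne_zero
    have hy : (y.den : ℚ) ≠ 0 := by exact_mod_cast y.den_ne_zero
    conv_lhs => rw [← Rat.num_div_den x, ← Rat.num_div_den y]
    push_cast
    field_simp
  rw [e]
  have hb : ((x.den : ℤ) * y.den).natAbs = x.den * y.den := by
    rw [Int.natAbs_mul]; simp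
  apply ht_divInt_le
  · exact mul_ne_zero (by exact_mod_cast x.den_ne_zero) (by exact_mod_cast y.den_ne_zero)
  · calc _ ≤ (x.num * y.den).natAbs + (y.num * x.den).natAbs := Int.natAbs_add_le _ _
      _ = x.num.natAbs * y.den + y.num.natAbs * x.den := by simp [Int.natAbs_mul]
      _ < 2 ^ ht x * 2 ^ ht y + 2 ^ ht y * 2 ^ ht x := by
          apply add_lt_add <;> exact Nat.mul_lt_mul'' (by assumption) (by assumption)
      _ = _ := by rw [pow_succ, pow_add]; ring
  · rw [hb]
    calc _ < 2 ^ ht x * 2 ^ ht y := Nat.mul_lt_mul'' h3 h4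
      _ ≤ _ := by rw [pow_succ, pow_add]; omega

theorem ht_neg (x : ℚ) : ht (-x) = ht x := by simp [ht]

theorem ht_sub_le (x y : ℚ) : ht (x - y) ≤ ht x + ht y + 1 := by
  rw [sub_eq_add_neg, ← ht_neg y]; exact ht_add_le _ _

theorem ht_mul_le (x y : ℚ) : ht (x * y) ≤ ht x + ht y := by
  have e : x * y = Rat.divInt (x.num * y.num) (x.den * y.den) := by
    rw [Rat.divInt_eq_div]
    conv_lhs => rw [← Rat.num_div_den x, ← Rat.num_div_den y]
    push_cast
    rw [div_mul_div_comm]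
  rw [e]
  apply ht_divInt_le
  · exact mul_ne_zero (by exact_mod_cast x.den_ne_zero) (by exact_mod_cast y.den_ne_zero)
  · rw [Int.natAbs_mul, pow_add]
    exact Nat.mul_lt_mul'' (num_lt_two_pow_ht x) (num_lt_two_pow_ht y)
  · rw [Int.natAbs_mul, pow_add]
    exact Nat.mul_lt_mul'' (den_lt_two_pow_ht x) (den_lt_two_pow_ht y)

theorem ht_inv_le (x : ℚ) : ht x⁻¹ ≤ ht x := by
  rcases eq_or_ne x 0 with rfl | h
  · simp
  · have e : x⁻¹ = Rat.divInt x.den x.num := by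
      rw [Rat.divInt_eq_div]
      conv_lhs => rw [← Rat.num_div_den x]
      rw [inv_div]; norm_cast
    rw [e]
    apply ht_divInt_le
    · exact Rat.num_ne_zero.2 h
    · exact den_lt_two_pow_ht x
    · exact num_lt_two_pow_ht x

theorem ht_div_le (x y : ℚ) : ht (x / y) ≤ ht x + ht y := by
  rw [div_eq_mul_inv]
  exact (ht_mul_le _ _).trans (Nat.add_le_add_left (ht_inv_le y) _)

theorem RatOp.ht_eval_le (o : RatOp) (x y : ℚ) : ht (o.eval x y) ≤ ht x + ht y + 1 := by
  cases o
  · exact ht_add_le x y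
  · exact ht_sub_le x y
  · exact (ht_mul_le x y).trans (Nat.le_succ _)
  · exact (ht_div_le x y).trans (Nat.le_succ _)

@[simp] theorem ht_zero : ht 0 = 1 := by simp [ht]

@[simp] theorem ht_one : ht 1 = 1 := by simp [ht]

theorem ht_natCast_le (n : ℕ) : ht n ≤ n + 1 := by
  unfold ht
  rw [Nat.size_le]
  simp only [Rat.num_natCast, Int.natAbs_natCast, Rat.den_natCast]
  have := Nat.lt_two_pow_self (n := n + 1)
  apply max_lt <;> omega

theorem ht_listSum_le {M : ℕ} (l : List ℚ) (h : ∀ x ∈ l, ht x ≤ M) :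
    ht l.sum ≤ l.length * (M + 1) + 1 := by
  induction l with
  | nil => simp
  | cons a l ih =>
    have h1 := ih fun x hx => h x (List.mem_cons_of_mem _ hx)
    have h2 := h a List.mem_cons_self
    have h3 := ht_add_le a l.sum
    rw [List.sum_cons, List.length_cons]
    nlinarith

/-! ### Expressions and their evaluation by programs -/

/-- Values of the arrays of a machine that are addressed by names in `V`. -/
abbrev Arrays (V : Type) : Type := V → ℕ → ℚ

def Mem.view {V : Type} (code : V → ℕ) (σ : Mem) : Arrays V := fun v k => σ.arr (code v) k

/-- All cells of the arrays have height at most `M`. -/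
def Bounded {V : Type} (M : ℕ) (S : Arrays V) : Prop := ∀ v k, ht (S v k) ≤ M

/-- Expressions in array cells; `ite a b e f` has the value of `e` if `a < b` and that of `f`
otherwise. -/
inductive Expr (V : Type) where
  | var (v : V) (r : ℕ)
  | const (c : ℚ)
  | op (o : RatOp) (e f : Expr V)
  | ite (a b e f : Expr V)

variable {V : Type}

namespace Expr

def eval (S : Arrays V) (ρ : ℕ → ℕ) : Expr V → ℚ
  | var v r => S v (ρ r)
  | const c => c
  | op o e f => o.eval (e.eval S ρ) (f.eval S ρ)
  | ite a b e f => if a.eval S ρ < b.eval S ρ then e.eval S ρ else f.eval S ρ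

/-- Growth factor of heights in the evaluation of an expression. -/
def growth : Expr V → ℕ
  | var _ _ => 1
  | const c => ht c
  | op _ e f => e.growth + f.growth + 1
  | ite a b e f => a.growth + b.growth + e.growth + f.growth

/-- The growth factor depends on the expression alone, so a program of fixed expressions multiplies
heights by a constant. Using M + 1 in place of M absorbs the additive constants. -/
theorem ht_eval_le {M : ℕ} {S : Arrays V} (hS : Bounded M S) (ρ : ℕ → ℕ) (e : Expr V) :
    ht (e.eval S ρ) ≤ e.growth * (M + 1) := by
  induction e with
  | var v r => simpa [eval, growth] using (hS v (ρ r)).trans (Nat.le_succ _)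
  | const c => simpa [eval, growth] using Nat.le_mul_of_pos_right _ (Nat.succ_pos M)
  | op o e f he hf =>
    have := o.ht_eval_le (e.eval S ρ) (f.eval S ρ)
    simp only [eval, growth]
    nlinarith
  | ite a b e f _ _ he hf =>
    simp only [eval, growth]
    split_ifs <;> nlinarith

/-- The program that stores the value of an expression in cell `reg z` of array `b`, using
the arrays from `b` on as scratch memory. -/
def compile (code : V → ℕ) (z : ℕ) : Expr V → ℕ → Prog
  | var v r, b => .instr (.ratMove b z (code v) r)
  | const c, b => .instr (.ratConst b z c)
  | op o e f, b =>
      .seq (e.compile code z b) <| .seq (f.compile code z (b + 1)) <|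
        match o with
        | .div => .seq (.instr (.ratConst (b + 2) z 0)) <|
            .ite (.ratLt (b + 1) z (b + 2) z) (.instr (.ratOp .div b z b z (b + 1) z)) <|
            .ite (.ratLt (b + 2) z (b + 1) z) (.instr (.ratOp .div b z b z (b + 1) z)) <|
            .instr (.ratConst b z 0)
        | o => .instr (.ratOp o b z b z (b + 1) z)
  | ite a b' e f, b =>
      .seq (a.compile code z b) <| .seq (b'.compile code z (b + 1)) <|
        .ite (.ratLt b z (b + 1) z) (e.compile code z b) (f.compile code z b)

def time : Expr V → ℕ
  | var _ _ => 1
  | const _ => 1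
  | op _ e f => e.time + f.time + 4
  | ite a b e f => a.time + b.time + e.time + f.time + 1

/-- Evaluation with scratch base b touches no array below b. Hence the second operand, evaluated
with base b + 1, preserves both the variables and the value of the first operand. The factor 2 in
the bound on L converts heights into bit sizes. -/
theorem run_compile (code : V → ℕ) (z W L M : ℕ) (e : Expr V) (b : ℕ) (hb : ∀ v, code v < b)
    (σ : Mem) (hz : σ.reg z = 0) (hS : Bounded M (σ.view code))
    (hL : 2 * (e.growth * (M + 1)) + 1 ≤ L) :
    ∃ T σ', T ≤ e.time ∧ Run W L (e.compile code z b) σ T σ' ∧ σ'.reg = σ.reg ∧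
      (∀ A < b, σ'.arr A = σ.arr A) ∧ σ'.arr b 0 = e.eval (σ.view code) σ.reg := by
  have key : ∀ e : Expr V, 2 * (e.growth * (M + 1)) + 1 ≤ L →
      ratSize (e.eval (σ.view code) σ.reg) ≤ L := fun e he =>
    (ratSize_le_ht _).trans (le_trans (by have := e.ht_eval_le hS σ.reg; omega) he)
  induction e generalizing σ b with
  | var v r =>
    refine ⟨1, _, le_rfl, .instr (.ratMove σ b z (code v) r ?_), rfl, ?_, ?_⟩
    · exact key (var v r) hL
    · intro A hA; simp [Mem.setArr, hA.ne]
    · simp [Mem.setArr, hz, eval, Mem.view]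
  | const c =>
    refine ⟨1, _, le_rfl, .instr (.ratConst σ b z c (key (const c) hL)), rfl, ?_, ?_⟩
    · intro A hA; simp [Mem.setArr, hA.ne]
    · simp [Mem.setArr, hz, eval]
  | op o e f he hf =>
    have hkey := key (op o e f) hL
    simp only [growth] at hL
    obtain ⟨T, σ₁, hT, hr, h1, h2, h3⟩ := he b hb σ hz hS (by nlinarith) key
    have hv : σ₁.view code = σ.view code := by
      funext v; funext k; simp only [Mem.view]; rw [h2 _ (hb v)]
    obtain ⟨T', σ₂, hT', hr', h1', h2', h3'⟩ := hf (b + 1) (fun v => (hb v).trans (Nat.lt_succ_self _))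
      σ₁ (by rw [h1, hz]) (by rw [hv]; exact hS) (by nlinarith) (by rw [hv, h1]; exact key)
    have hz2 : σ₂.reg z = 0 := by rw [h1', h1, hz]
    have hA : ∀ A < b, σ₂.arr A = σ.arr A := fun A hA => by
      rw [h2' A (hA.trans (Nat.lt_succ_self _)), h2 A hA]
    have hx : σ₂.arr b 0 = e.eval (σ.view code) σ.reg := by
      rw [h2' b (Nat.lt_succ_self _), h3]
    have hy : σ₂.arr (b + 1) 0 = f.eval (σ.view code) σ.reg := by rw [h3', hv, h1]
    have hL3 : 2 ≤ L := by nlinarith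
    have h0 : ratSize 0 ≤ L := by simpa [ratSize] using hL3
    -- The final operation may start from a memory that differs from σ₂ in scratch arrays from b + 2
    -- on; division needs this.
    have fin : ∀ (σ₃ : Mem), σ₃.reg = σ₂.reg → (∀ A < b + 2, σ₃.arr A = σ₂.arr A) →
        (o = RatOp.div → f.eval (σ.view code) σ.reg ≠ 0) →
        ∃ σ', Run W L (.instr (.ratOp o b z b z (b + 1) z)) σ₃ 1 σ' ∧ σ'.reg = σ.reg ∧
          (∀ A < b, σ'.arr A = σ.arr A) ∧ σ'.arr b 0 = (op o e f).eval (σ.view code) σ.reg := by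
      intro σ₃ hr3 ha3 hne
      have e1 : σ₃.arr b (σ₃.reg z) = e.eval (σ.view code) σ.reg := by
        rw [hr3, hz2, ha3 b (by omega), hx]
      have e2 : σ₃.arr (b + 1) (σ₃.reg z) = f.eval (σ.view code) σ.reg := by
        rw [hr3, hz2, ha3 (b + 1) (by omega), hy]
      refine ⟨_, .instr (.ratOp σ₃ o b z b z (b + 1) z ?_ ?_), ?_, ?_, ?_⟩
      · rw [e2]; exact hne
      · rw [e1, e2]; exact hkey
      · simp [Mem.setArr, hr3, h1', h1]
      · intro A h; simp [Mem.setArr, h.ne, ha3 A (by omega), hA A h]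
      · rw [e1, e2, hr3, hz2]; simp [Mem.setArr, eval]
    by_cases ho : o = RatOp.div
    · subst ho
      -- Division by zero is not executable, so the divisor is compared with a stored zero in both
      -- directions. If both tests fail, the result 0 is written, in agreement with x / 0 = 0.
      set σ₃ := σ₂.setArr (b + 2) (σ₂.reg z) 0 with hσ₃
      have r3 : Run W L (.instr (.ratConst (b + 2) z 0)) σ₂ 1 σ₃ :=
        .instr (.ratConst σ₂ (b + 2) z 0 h0)
      have g1 : σ₃.reg = σ₂.reg := rfl
      have g2 : ∀ A < b + 2, σ₃.arr A = σ₂.arr A := fun A h => by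
        simp [hσ₃, Mem.setArr, h.ne]
      have g3 : σ₃.arr (b + 2) (σ₃.reg z) = 0 := by simp [hσ₃, Mem.setArr]
      have g4 : σ₃.arr (b + 1) (σ₃.reg z) = f.eval (σ.view code) σ.reg := by
        rw [g1, hz2, g2 _ (by omega), hy]
      rcases lt_trichotomy (f.eval (σ.view code) σ.reg) 0 with h | h | h
      · obtain ⟨σ', q1, q2, q3, q4⟩ := fin σ₃ g1 g2 fun _ => h.ne
        refine ⟨_, σ', ?_, .seq hr (.seq hr' (.seq r3 (.ite_true ?_ q1))), q2, q3, q4⟩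
        · simp only [time]; omega
        · simpa [Test.Holds, g3, g4] using h
      · refine ⟨_, σ₃.setArr b (σ₃.reg z) 0, ?_, .seq hr (.seq hr' (.seq r3 (.ite_false ?_ (.ite_false ?_
          (.instr (.ratConst σ₃ b z 0 h0)))))), ?_, ?_, ?_⟩
        · simp only [time]; omega
        · simp [Test.Holds, g3, g4, h]
        · simp [Test.Holds, g3, g4, h]
        · simp [Mem.setArr, g1, h1', h1]
        · intro A h; simp [Mem.setArr, h.ne, g2 A (by omega), hA A h]
        · rw [g1, hz2]; simp [Mem.setArr, eval, RatOp.eval, h]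
      · obtain ⟨σ', q1, q2, q3, q4⟩ := fin σ₃ g1 g2 fun _ => h.ne'
        refine ⟨_, σ', ?_, .seq hr (.seq hr' (.seq r3 (.ite_false ?_ (.ite_true ?_ q1)))), q2, q3, q4⟩
        · simp only [time]; omega
        · simpa [Test.Holds, g3, g4] using h.le
        · simpa [Test.Holds, g3, g4] using h
    · obtain ⟨σ', q1, q2, q3, q4⟩ := fin σ₂ rfl (fun _ _ => rfl) fun h => absurd h ho
      refine ⟨T + (T' + 1), σ', ?_, ?_, q2, q3, q4⟩
      · simp only [time]; omega
      · cases o <;> first | exact .seq hr (.seq hr' q1) | exact absurd rfl ho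
  | ite a c e f ha hc he hf =>
    simp only [growth] at hL
    obtain ⟨T, σ₁, hT, hr, h1, h2, h3⟩ := ha b hb σ hz hS (by nlinarith) key
    have hv : σ₁.view code = σ.view code := by
      funext v; funext k; simp only [Mem.view]; rw [h2 _ (hb v)]
    obtain ⟨T', σ₂, hT', hr', h1', h2', h3'⟩ := hc (b + 1) (fun v => (hb v).trans (Nat.lt_succ_self _))
      σ₁ (by rw [h1, hz]) (by rw [hv]; exact hS) (by nlinarith) (by rw [hv, h1]; exact key)
    have hreg : σ₂.reg = σ.reg := by rw [h1', h1]
    have hz2 : σ₂.reg z = 0 := by rw [hreg, hz]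
    have hA : ∀ A < b, σ₂.arr A = σ.arr A := fun A hA => by
      rw [h2' A (hA.trans (Nat.lt_succ_self _)), h2 A hA]
    have hx : σ₂.arr b 0 = a.eval (σ.view code) σ.reg := by
      rw [h2' b (Nat.lt_succ_self _), h3]
    have hy : σ₂.arr (b + 1) 0 = c.eval (σ.view code) σ.reg := by rw [h3', hv, h1]
    have hv2 : σ₂.view code = σ.view code := by
      funext v; funext k; simp only [Mem.view]; rw [hA _ (hb v)]
    by_cases h : a.eval (σ.view code) σ.reg < c.eval (σ.view code) σ.reg
    · obtain ⟨T₃, σ', k1, k2, k3, k4, k5⟩ := he b hb σ₂ hz2 (by rw [hv2]; exact hS) (by nlinarith)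
        (by rw [hv2, hreg]; exact key)
      refine ⟨_, σ', ?_, .seq hr (.seq hr' (.ite_true ?_ k2)), by rw [k3, hreg], fun A h => by
        rw [k4 A h, hA A h], ?_⟩
      · simp only [time]; omega
      · simpa [Test.Holds, hz2, hx, hy] using h
      · rw [k5, hv2, hreg]; simp [eval, h]
    · obtain ⟨T₃, σ', k1, k2, k3, k4, k5⟩ := hf b hb σ₂ hz2 (by rw [hv2]; exact hS) (by nlinarith)
        (by rw [hv2, hreg]; exact key)
      refine ⟨_, σ', ?_, .seq hr (.seq hr' (.ite_false ?_ k2)), by rw [k3, hreg], fun A h => by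
        rw [k4 A h, hA A h], ?_⟩
      · simp only [time]; omega
      · simpa [Test.Holds, hz2, hx, hy] using h
      · rw [k5, hv2, hreg]; simp [eval, h]

end Expr
end StronglyPoly

/-! ### Verified building blocks: expressible functions, assignments, nested loops. -/

namespace StronglyPoly

variable {V : Type}

/-! ### Expressible functions -/

/-- `f` is the value of an expression in the arrays and the registers. -/
def Expressible (f : Arrays V → (ℕ → ℕ) → ℚ) : Prop := ∃ e : Expr V, e.eval = f

namespace Expressible

theorem var (v : V) (r : ℕ) : Expressible fun S ρ => S v (ρ r) := ⟨.var v r, rfl⟩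

theorem const (c : ℚ) : Expressible fun (_ : Arrays V) _ => c := ⟨.const c, rfl⟩

variable {f g h k : Arrays V → (ℕ → ℕ) → ℚ}

theorem add (hf : Expressible f) (hg : Expressible g) :
    Expressible fun S ρ => f S ρ + g S ρ := by
  obtain ⟨e, rfl⟩ := hf; obtain ⟨e', rfl⟩ := hg; exact ⟨.op .add e e', rfl⟩

theorem sub (hf : Expressible f) (hg : Expressible g) :
    Expressible fun S ρ => f S ρ - g S ρ := by
  obtain ⟨e, rfl⟩ := hf; obtain ⟨e', rfl⟩ := hg; exact ⟨.op .sub e e', rfl⟩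

theorem mul (hf : Expressible f) (hg : Expressible g) :
    Expressible fun S ρ => f S ρ * g S ρ := by
  obtain ⟨e, rfl⟩ := hf; obtain ⟨e', rfl⟩ := hg; exact ⟨.op .mul e e', rfl⟩

theorem div (hf : Expressible f) (hg : Expressible g) :
    Expressible fun S ρ => f S ρ / g S ρ := by
  obtain ⟨e, rfl⟩ := hf; obtain ⟨e', rfl⟩ := hg; exact ⟨.op .div e e', rfl⟩

open Classical in
theorem iteLt (hf : Expressible f) (hg : Expressible g) (hh : Expressible h)
    (hk : Expressible k) : Expressible fun S ρ => if f S ρ < g S ρ then h S ρ else k S ρ := by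
  obtain ⟨e₁, rfl⟩ := hf; obtain ⟨e₂, rfl⟩ := hg; obtain ⟨e₃, rfl⟩ := hh; obtain ⟨e₄, rfl⟩ := hk
  refine ⟨.ite e₁ e₂ e₃ e₄, ?_⟩
  funext S ρ
  simp [Expr.eval]

theorem sum {B : Type*} (s : Finset B) {f : B → Arrays V → (ℕ → ℕ) → ℚ}
    (hf : ∀ b, Expressible (f b)) : Expressible fun S ρ => ∑ b ∈ s, f b S ρ := by
  classical
  induction s using Finset.induction_on with
  | empty => simpa using const 0
  | insert a s ha ih => simpa [Finset.sum_insert ha] using (hf a).add ih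

theorem prod {B : Type*} (s : Finset B) {f : B → Arrays V → (ℕ → ℕ) → ℚ}
    (hf : ∀ b, Expressible (f b)) : Expressible fun S ρ => ∏ b ∈ s, f b S ρ := by
  classical
  induction s using Finset.induction_on with
  | empty => simpa using const 1
  | insert a s ha ih => simpa [Finset.prod_insert ha] using (hf a).mul ih

/-- Heights grow linearly in the evaluation of an expressible function. -/
theorem exists_ht_le (hf : Expressible f) :
    ∃ C, ∀ M S ρ, Bounded M S → ht (f S ρ) ≤ C * (M + 1) := by
  obtain ⟨e, rfl⟩ := hf
  exact ⟨e.growth, fun M S ρ hS => e.ht_eval_le hS ρ⟩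

end Expressible

open Classical in
/-- A predicate that can be decided by evaluation of an expression. -/
def Decides (P : Arrays V → (ℕ → ℕ) → Prop) : Prop :=
  Expressible fun S ρ => if P S ρ then 1 else 0

theorem Decides.ite {P : Arrays V → (ℕ → ℕ) → Prop} [∀ S ρ, Decidable (P S ρ)] {f g : Arrays V → (ℕ → ℕ) → ℚ}
    (hP : Decides P) (hf : Expressible f) (hg : Expressible g) :
    Expressible fun S ρ => if P S ρ then f S ρ else g S ρ := by
  convert (Expressible.const 0).iteLt hP hf hg using 4
  split_ifs <;> simp_all

theorem Expressible.lt {f g : Arrays V → (ℕ → ℕ) → ℚ} (hf : Expressible f)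
    (hg : Expressible g) : Decides fun S ρ => f S ρ < g S ρ := by
  unfold Decides
  convert hf.iteLt hg (.const 1) (.const 0) using 3
  split_ifs <;> rfl

theorem Expressible.eq {f g : Arrays V → (ℕ → ℕ) → ℚ} (hf : Expressible f)
    (hg : Expressible g) : Decides fun S ρ => f S ρ = g S ρ := by
  unfold Decides
  convert (hf.lt hg).ite (.const 0) ((hg.lt hf).ite (.const 0) (.const 1)) using 3 with S ρ
  rcases lt_trichotomy (f S ρ) (g S ρ) with h | h | h
  · simp [h, h.ne]
  · simp [h]
  · simp [h, h.ne', h.not_gt]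

open Classical in
/-- Every function of finitely many decidable conditions is expressible. -/
theorem Expressible.table {B : Type} [Finite B] (H : (B → Prop) → ℚ)
    {P : B → Arrays V → (ℕ → ℕ) → Prop} (hP : ∀ b, Decides (P b)) :
    Expressible fun S ρ => H fun b => P b S ρ := by
  induction B using Finite.induction_empty_option with
  | of_equiv e ih =>
    convert ih (fun p => H fun b => p (e.symm b)) (P := fun a => P (e a)) (fun a => hP _) using 4
    simp
  | h_empty =>
    have : (fun S ρ => H fun b => P b S ρ) = fun _ _ => H PEmpty.elim := by
      funext S ρ
      congr 1
      funext b
      exact b.elim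
    rw [this]
    exact .const _
  | h_option ih =>
    -- Branch on the truth value of the additional condition and use a smaller table in each branch.
    have := (hP none).ite
      (ih (fun p => H fun b => b.elim True p) (P := fun a => P (some a)) fun a => hP _)
      (ih (fun p => H fun b => b.elim False p) (P := fun a => P (some a)) fun a => hP _)
    convert this using 3
    split_ifs with h <;> congr 1 <;> funext b <;> cases b <;> simp [h]

/-! ### Hoare triples -/

/-- Started with register contents `ρ` and arrays satisfying `P`, the program `c` halts within
`T` steps with the same register contents and with arrays satisfying `Q`. -/
def Triple (code : V → ℕ) (W L T : ℕ) (ρ : ℕ → ℕ) (c : Prog) (P Q : Arrays V → Prop) : Prop :=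
  ∀ σ : Mem, σ.reg = ρ → P (σ.view code) →
    ∃ T' σ', T' ≤ T ∧ Run W L c σ T' σ' ∧ σ'.reg = ρ ∧ Q (σ'.view code)

namespace Triple

/-- This allows a postcondition to refer to the arrays at the start. -/
theorem of_forall {code : V → ℕ} {W L T : ℕ} {ρ : ℕ → ℕ} {c : Prog} {P Q : Arrays V → Prop}
    (h : ∀ S, P S → Triple code W L T ρ c (· = S) Q) : Triple code W L T ρ c P Q :=
  fun σ h1 h2 => h _ h2 σ h1 rfl

variable {code : V → ℕ} {W L T T₁ T₂ : ℕ} {ρ : ℕ → ℕ} {c d : Prog} {P Q R : Arrays V → Prop}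

theorem mono (hT : T₁ ≤ T₂) {P' Q' : Arrays V → Prop} (hP : ∀ S, P' S → P S)
    (hQ : ∀ S, Q S → Q' S) (h : Triple code W L T₁ ρ c P Q) : Triple code W L T₂ ρ c P' Q' := by
  intro σ h1 h2
  obtain ⟨T', σ', a, b, e, f⟩ := h σ h1 (hP _ h2)
  exact ⟨T', σ', a.trans hT, b, e, hQ _ f⟩

theorem seq (hc : Triple code W L T₁ ρ c P Q) (hd : Triple code W L T₂ ρ d Q R) :
    Triple code W L (T₁ + T₂) ρ (.seq c d) P R := by
  intro σ h1 h2
  obtain ⟨T', σ', a, b, e, f⟩ := hc σ h1 h2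
  obtain ⟨T'', σ'', a', b', e', f'⟩ := hd σ' e f
  exact ⟨_, σ'', Nat.add_le_add a a', .seq b b', e', f'⟩

end Triple

/-- Result of a simultaneous assignment: the cells `(D b, ρ (d b))`, `b ∈ l`, contain the values
`x b`, and all other cells are as before. -/
structure Assigned {B : Type} (D : B → V) (d : B → ℕ) (x : B → ℚ) (ρ : ℕ → ℕ) (l : List B)
    (S S' : Arrays V) : Prop where
  hit : ∀ b ∈ l, S' (D b) (ρ (d b)) = x b
  miss : ∀ v k, (∀ b ∈ l, D b = v → ρ (d b) ≠ k) → S' v k = S v k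

theorem Assigned.miss_array {B : Type} {D : B → V} {d : B → ℕ} {x : B → ℚ} {ρ : ℕ → ℕ}
    {l : List B} {S S' : Arrays V} (h : Assigned D d x ρ l S S') (v : V) (hv : ∀ b, D b ≠ v) :
    S' v = S v := funext fun k => h.miss v k fun b _ hb => absurd hb (hv b)

/-- The program assigning to the cell `(D, reg d)` the value of `e`. -/
def assign (code : V → ℕ) (z b : ℕ) (D : V) (d : ℕ) (e : Expr V) : Prog :=
  .seq (e.compile code z b) (.instr (.ratMove (code D) d b z))

theorem run_assign {code : V → ℕ} (hcode : code.Injective) {z b W L M : ℕ} {ρ : ℕ → ℕ}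
    (hb : ∀ v, code v < b) (hz : ρ z = 0) (D : V) (d : ℕ) (e : Expr V)
    (hL : 2 * (e.growth * (M + 1)) + 1 ≤ L) {σ : Mem} (hσ : σ.reg = ρ)
    (hS : Bounded M (σ.view code)) :
    ∃ T σ', T ≤ e.time + 1 ∧ Run W L (assign code z b D d e) σ T σ' ∧ σ'.reg = ρ ∧
      σ'.view code (D) (ρ d) = e.eval (σ.view code) ρ ∧
      ∀ v k, ¬ (v = D ∧ k = ρ d) → σ'.view code v k = σ.view code v k := by
  obtain ⟨T, σ₁, hT, hr, h1, h2, h3⟩ := e.run_compile code z W L M b hb σ (hσ ▸ hz) hS hL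
  have hv : σ₁.view code = σ.view code := by
    funext v; funext k; simp only [Mem.view]; rw [h2 _ (hb v)]
  have hz1 : σ₁.reg z = 0 := by rw [h1, hσ, hz]
  refine ⟨T + 1, _, by omega, .seq hr (.instr (.ratMove σ₁ (code D) d b z ?_)), ?_, ?_, ?_⟩
  · rw [hz1, h3]
    exact (ratSize_le_ht _).trans (le_trans (by have := e.ht_eval_le hS σ.reg; omega) hL)
  · simp [Mem.setArr, h1, hσ]
  · simp [Mem.view, Mem.setArr, h1, hσ, hz, h3]
  · intro v k h
    rw [← hv]
    by_cases hvD : v = D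
    · subst hvD
      have hk : k ≠ ρ d := fun hk => h ⟨rfl, hk⟩
      simp [Mem.view, Mem.setArr, h1, hσ, hk]
    · simp [Mem.view, Mem.setArr, hcode.ne hvD]

/-- Simultaneous assignment of expressible values to cells of distinct arrays, where the value for
an array does not depend on the other arrays that are assigned to. -/
theorem exists_assign {code : V → ℕ} (hcode : code.Injective) {z b₀ : ℕ}
    (hb : ∀ v, code v < b₀) {B : Type} [Fintype B] {D : B → V} (hD : D.Injective) (d : B → ℕ)
    {f : B → Arrays V → (ℕ → ℕ) → ℚ} (hf : ∀ b, Expressible (f b))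
    (hind : ∀ b S S' ρ, (∀ v, (v = D b ∨ ∀ b', v ≠ D b') → S v = S' v) → f b S ρ = f b S' ρ) :
    ∃ c C, ∀ W L M ρ, ∀ P Q : Arrays V → Prop, ρ z = 0 → C * (M + 1) ≤ L →
      (∀ S, P S → Bounded M S ∧ (∀ b, ht (f b S ρ) ≤ M) ∧
        ∀ S', Bounded M S' → Assigned D d (fun b => f b S ρ) ρ Finset.univ.toList S S' → Q S') →
      Triple code W L C ρ c P Q := by
  suffices H : ∀ l : List B, l.Nodup → ∃ c C, ∀ W L M ρ, ∀ P Q : Arrays V → Prop,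
      ρ z = 0 → C * (M + 1) ≤ L →
      (∀ S, P S → Bounded M S ∧ (∀ b, ht (f b S ρ) ≤ M) ∧
        ∀ S', Bounded M S' → Assigned D d (fun b => f b S ρ) ρ l S S' → Q S') →
      Triple code W L C ρ c P Q by
    obtain ⟨c, C, h⟩ := H _ (Finset.nodup_toList _)
    exact ⟨c, C, h⟩
  intro l
  induction l with
  | nil =>
    intro _
    refine ⟨.skip, 1, fun W L M ρ P Q _ _ h σ h1 h2 => ⟨1, σ, le_rfl, .skip σ, h1, ?_⟩⟩
    exact (h _ h2).2.2 _ (h _ h2).1 ⟨by simp, fun _ _ _ => rfl⟩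
  | cons a l ih =>
    intro hl
    rw [List.nodup_cons] at hl
    obtain ⟨c, C, hc⟩ := ih hl.2
    obtain ⟨e, he⟩ := hf a
    refine ⟨.seq c (assign code z b₀ (D a) (d a) e), C + (2 * e.growth + e.time + 2), ?_⟩
    intro W L M ρ P Q hz hL h
    have hL1 : C * (M + 1) ≤ L := by nlinarith
    have hL2 : 2 * (e.growth * (M + 1)) + 1 ≤ L := by nlinarith
    intro σ h1 h2
    obtain ⟨h3, h4, h5⟩ := h _ h2
    obtain ⟨T, σ₁, k1, k2, k3, k4, k5⟩ := hc W L M ρ (· = σ.view code)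
      (fun S' => Bounded M S' ∧ Assigned D d (fun b => f b (σ.view code) ρ) ρ l (σ.view code) S')
      hz hL1 (by rintro _ rfl; exact ⟨h3, h4, fun S' h h' => ⟨h, h'⟩⟩) σ h1 rfl
    obtain ⟨T', σ₂, m1, m2, m3, m4, m5⟩ := run_assign hcode hb hz (D a) (d a) e hL2 k3 k4
    -- The assignments already made for l are invisible to f a: it reads no assigned array except
    -- its own, and that one is not yet overwritten because a ∉ l.
    have hval : e.eval (σ₁.view code) ρ = f a (σ.view code) ρ := by
      refine (congrFun (congrFun he _) _).trans (hind _ _ _ _ fun v hv => ?_)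
      funext k
      refine k5.miss v k fun b hbl hbv => ?_
      rcases hv with rfl | hv
      · exact absurd (hD hbv ▸ hbl) hl.1
      · exact absurd hbv.symm (hv b)
    rw [hval] at m4
    refine ⟨T + T', σ₂, by omega, .seq k2 m2, m3, h5 _ ?_ ⟨?_, ?_⟩⟩
    · intro v k
      by_cases hvk : v = D a ∧ k = ρ (d a)
      · rw [hvk.1, hvk.2, m4]; exact h4 a
      · rw [m5 v k hvk]; exact k4 v k
    · intro b hbl
      rcases List.mem_cons.1 hbl with rfl | hbl
      · exact m4
      · rw [m5 _ _ fun hh => hl.1 (hD hh.1 ▸ hbl)]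
        exact k5.hit b hbl
    · intro v k hvk
      rw [m5 v k fun hh => hvk a List.mem_cons_self hh.1.symm hh.2.symm]
      exact k5.miss v k fun b hbl => hvk b (List.mem_cons_of_mem _ hbl)

/-! ### Nested loops -/

/-- Nested counting loops with the pairs (counter, bound) in `l`, and with body `c`. -/
def nest (one : ℕ) : List (ℕ × ℕ) → Prog → Prog
  | [], c => c
  | (r, b) :: l, c =>
      .seq (.loop (.idxLt r b) (.seq (nest one l c) (.instr (.idxOp .add r r one))))
        (.instr (.idxConst r 0))

/-- The register contents in the successive executions of the body of nested loops. -/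
def enum : List (ℕ × ℕ) → (ℕ → ℕ) → List (ℕ → ℕ)
  | [], ρ => [ρ]
  | (r, b) :: l, ρ => (List.range (ρ b)).flatMap fun v => enum l (Function.update ρ r v)

/-- A bound for the running time of `m` nested loops. -/
def nestTime (N T : ℕ) : ℕ → ℕ
  | 0 => T
  | m + 1 => N * (nestTime N T m + 2) + 2

/-- The loop registers can be used for nested loops started with register contents `ρ`. -/
structure LoopRegs (one N : ℕ) (l : List (ℕ × ℕ)) (ρ : ℕ → ℕ) : Prop where
  nodup : (l.map Prod.fst).Nodup
  fresh : ∀ p ∈ l, ∀ p' ∈ l, p.1 ≠ p'.2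
  ne_one : ∀ p ∈ l, p.1 ≠ one
  counter : ∀ p ∈ l, ρ p.1 = 0
  bound : ∀ p ∈ l, ρ p.2 ≤ N
  reg_one : ρ one = 1

theorem LoopRegs.tail {one N r b : ℕ} {l : List (ℕ × ℕ)} {ρ : ℕ → ℕ}
    (h : LoopRegs one N ((r, b) :: l) ρ) (v : ℕ) :
    LoopRegs one N l (Function.update ρ r v) := by
  have hn := h.nodup
  simp only [List.map_cons, List.nodup_cons] at hn
  refine ⟨hn.2, fun p hp p' hp' => h.fresh p (.tail _ hp) p' (.tail _ hp'),
    fun p hp => h.ne_one p (.tail _ hp), fun p hp => ?_, fun p hp => ?_, ?_⟩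
  · rw [Function.update_of_ne fun hh : p.1 = r => hn.1 (hh ▸ List.mem_map_of_mem hp)]
    exact h.counter p (.tail _ hp)
  · rw [Function.update_of_ne (h.fresh (r, b) (.head _) p (.tail _ hp)).symm]
    exact h.bound p (.tail _ hp)
  · rw [Function.update_of_ne (h.ne_one (r, b) (.head _)).symm]
    exact h.reg_one

/-- The invariant is indexed by the list of register contents for which the body has already run.
Requiring a prefix of `enum l ρ` tells the body both which pass it is in and that this pass belongs
to the enumeration. -/
theorem triple_nest {code : V → ℕ} {W L T N one : ℕ} (hW : N ≤ W) {c : Prog}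
    (l : List (ℕ × ℕ)) (ρ : ℕ → ℕ) (hl : LoopRegs one N l ρ)
    (I : List (ℕ → ℕ) → Arrays V → Prop)
    (hc : ∀ m ρ', m ++ [ρ'] <+: enum l ρ → Triple code W L T ρ' c (I m) (I (m ++ [ρ']))) :
    Triple code W L (nestTime N T l.length) ρ (nest one l c) (I []) (I (enum l ρ)) := by
  induction l generalizing ρ I with
  | nil => simpa [nestTime, nest, enum] using hc [] ρ (by simp [enum])
  | cons p l ih =>
    obtain ⟨r, b⟩ := p
    have hrb : r ≠ b := hl.fresh (r, b) (.head _) (r, b) (.head _)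
    have hr1 : r ≠ one := hl.ne_one (r, b) (.head _)
    have hr0 : ρ r = 0 := hl.counter (r, b) (.head _)
    have hN : ρ b ≤ N := hl.bound (r, b) (.head _)
    set F : ℕ → List (ℕ → ℕ) := fun v =>
      (List.range v).flatMap fun v => enum l (Function.update ρ r v) with hF
    have hFs : ∀ v, F (v + 1) = F v ++ enum l (Function.update ρ r v) := fun v => by
      simp [hF, List.range_succ]
    have hFp : ∀ v w, v ≤ w → F v <+: F w := by
      intro v w h
      induction w, h using Nat.le_induction with
      | base => exact List.prefix_rfl
      | succ w _ ihw => exact ihw.trans (by rw [hFs]; exact List.prefix_append _ _)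
    -- The inner loops use the invariant shifted by F v, the passes completed for smaller values of
    -- the outer counter.
    have hbody : ∀ v < ρ b, Triple code W L (nestTime N T l.length) (Function.update ρ r v)
        (nest one l c) (I (F v)) (I (F (v + 1))) := by
      intro v hv
      have := ih (Function.update ρ r v) (hl.tail v) (fun m => I (F v ++ m)) (fun m ρ' hm => by
        have := hc (F v ++ m) ρ' (by
          refine List.IsPrefix.trans ?_ (hFp (v + 1) (ρ b) hv)
          rw [hFs, List.append_assoc]
          exact (List.prefix_append_right_inj _).2 hm)
        rwa [List.append_assoc] at this)
      rw [hFs]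
      simpa using this
    have hloop : ∀ n v, v + n = ρ b → ∀ σ : Mem, σ.reg = Function.update ρ r v →
        I (F v) (σ.view code) → ∃ T' σ', T' ≤ n * (nestTime N T l.length + 2) + 1 ∧
          Run W L (.loop (.idxLt r b) (.seq (nest one l c) (.instr (.idxOp .add r r one)))) σ T' σ' ∧
          σ'.reg = Function.update ρ r (ρ b) ∧ I (F (ρ b)) (σ'.view code) := by
      intro n
      induction n with
      | zero =>
        intro v hv σ h1 h2
        rw [add_zero] at hv
        subst hv
        refine ⟨1, σ, by omega, .loop_false ?_, h1, h2⟩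
        simp [Test.Holds, h1, hrb.symm]
      | succ n ihn =>
        intro v hv σ h1 h2
        obtain ⟨T₁, σ₁, a1, a2, a3, a4⟩ := hbody v (by omega) σ h1 h2
        have hstep : IdxOp.eval .add (σ₁.reg r) (σ₁.reg one) = v + 1 := by
          rw [a3]; simp [IdxOp.eval, hr1.symm, hl.reg_one]
        obtain ⟨T₂, σ₂, b1, b2, b3, b4⟩ := ihn (v + 1) (by omega) (σ₁.setReg r (v + 1))
          (by simp [Mem.setReg, a3]) a4
        refine ⟨1 + (T₁ + 1) + T₂, σ₂, ?_, .loop_true ?_ (.seq a2 (.instr ?_)) b2, b3, b4⟩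
        · rw [Nat.succ_mul]; omega
        · simp [Test.Holds, h1, hrb.symm]; omega
        · have := Step.idxOp (W := W) (L := L) σ₁ .add r r one (by rw [hstep]; omega)
          rwa [hstep] at this
    intro σ h1 h2
    obtain ⟨T', σ', a1, a2, a3, a4⟩ := hloop (ρ b) 0 (by omega) σ
      (by rw [h1, ← hr0, Function.update_eq_self]) h2
    -- Resetting the counter restores ρ, as a triple demands, and lets the loop be entered again
    -- from an outer one.
    refine ⟨T' + 1, σ'.setReg r 0, ?_, .seq a2 (.instr (.idxConst σ' r 0 (Nat.zero_le _))), ?_, a4⟩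
    · have : ρ b * (nestTime N T l.length + 2) ≤ N * (nestTime N T l.length + 2) :=
        Nat.mul_le_mul_right _ hN
      simp only [List.length_cons, nestTime]
      omega
    · simp only [Mem.setReg, a3, Function.update_idem]
      rw [← hr0, Function.update_eq_self]

theorem mem_enum {one N : ℕ} {l : List (ℕ × ℕ)} {ρ ρ' : ℕ → ℕ} (hl : LoopRegs one N l ρ) :
    ρ' ∈ enum l ρ ↔ (∀ p ∈ l, ρ' p.1 < ρ p.2) ∧ ∀ r, (∀ p ∈ l, p.1 ≠ r) → ρ' r = ρ r := by
  induction l generalizing ρ with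
  | nil => simp [enum, funext_iff]
  | cons p l ih =>
    obtain ⟨r, b⟩ := p
    have hn := hl.nodup
    simp only [List.map_cons, List.nodup_cons] at hn
    have hr : ∀ p ∈ l, p.1 ≠ r := fun p hp h => hn.1 (h ▸ List.mem_map_of_mem hp)
    have hf : ∀ p ∈ l, p.2 ≠ r := fun p hp =>
      (hl.fresh (r, b) (.head _) p (.tail _ hp)).symm
    simp only [enum, List.mem_flatMap, List.mem_range, List.forall_mem_cons]
    constructor
    · rintro ⟨v, hv, h⟩
      obtain ⟨h1, h2⟩ := (ih (hl.tail v)).1 h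
      have hr' : ρ' r = v := by rw [h2 r hr, Function.update_self]
      refine ⟨⟨by rwa [hr'], fun p hp => ?_⟩, fun r' h' => ?_⟩
      · have := h1 p hp
        rwa [Function.update_of_ne (hf p hp)] at this
      · rw [h2 r' h'.2, Function.update_of_ne (Ne.symm h'.1)]
    · rintro ⟨⟨h1, h2⟩, h3⟩
      refine ⟨ρ' r, h1, (ih (hl.tail _)).2 ⟨fun p hp => ?_, fun r' h' => ?_⟩⟩
      · rw [Function.update_of_ne (hf p hp)]; exact h2 p hp
      · by_cases h : r' = r
        · subst h; simp
        · rw [Function.update_of_ne h]; exact h3 r' ⟨Ne.symm h, h'⟩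

theorem nodup_enum {one N : ℕ} {l : List (ℕ × ℕ)} {ρ : ℕ → ℕ} (hl : LoopRegs one N l ρ) :
    (enum l ρ).Nodup := by
  induction l generalizing ρ with
  | nil => simp [enum]
  | cons p l ih =>
    obtain ⟨r, b⟩ := p
    have hn := hl.nodup
    simp only [List.map_cons, List.nodup_cons] at hn
    have hr : ∀ p ∈ l, p.1 ≠ r := fun p hp h => hn.1 (h ▸ List.mem_map_of_mem hp)
    rw [enum, List.nodup_flatMap]
    refine ⟨fun v _ => ih (hl.tail v), List.nodup_range.imp fun {v w} hvw => ?_⟩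
    rw [Function.onFun, List.disjoint_left]
    intro ρ' h1 h2
    apply hvw
    have e1 := ((mem_enum (hl.tail v)).1 h1).2 r hr
    have e2 := ((mem_enum (hl.tail w)).1 h2).2 r hr
    rw [e1] at e2
    simpa using e2

theorem length_enum_le {one N : ℕ} {l : List (ℕ × ℕ)} {ρ : ℕ → ℕ} (hl : LoopRegs one N l ρ) :
    (enum l ρ).length ≤ N ^ l.length := by
  induction l generalizing ρ with
  | nil => simp [enum]
  | cons p l ih =>
    obtain ⟨r, b⟩ := p
    rw [enum, List.length_flatMap, List.length_cons, pow_succ']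
    refine (List.sum_le_card_nsmul _ (N ^ l.length) ?_).trans ?_
    · simp only [List.mem_map]
      rintro _ ⟨v, _, rfl⟩
      exact ih (hl.tail v)
    · rw [List.length_map, List.length_range, smul_eq_mul]
      exact Nat.mul_le_mul_right _ (hl.bound (r, b) (.head _))

end StronglyPoly

/-! ### Combinatorial core: sign patterns, row types and short descriptions of an optimum. -/

namespace BTF

/-! ### Sign patterns of linear functionals on a finite set of points -/

/-- Elimination of the first coordinate of `x` by means of the pivot vector `p`. -/
def elim {d : ℕ} (p x : Fin (d + 1) → ℚ) : Fin d → ℚ := fun i => x i.succ - x 0 / p 0 * p i.succ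

/-- A number whose sign is the sign at `x` of the functional that is described by the pivot
vectors `pv` and the signs `sg`. -/
def pat : {d : ℕ} → (x : Fin d → ℚ) → (pv : Fin d → Fin d → ℚ) → (sg : Fin d → ℚ) → ℚ
  | 0, _, _, _ => 0
  | _ + 1, x, pv, sg =>
    let u := pat (elim (pv 0) x) (fun i => elim (pv 0) (pv i.succ)) fun i => sg i.succ
    if u = 0 then sg 0 * x 0 else u

/-- A shift θ of absolute value at most |a / b| can make a / b + θ vanish but cannot reverse its
sign. If it vanishes, then a = -θ b, so the sign of -θ recovers the lost information. -/
theorem sign_shift {a b θ : ℚ} (hθ : b ≠ 0 → |θ| ≤ |a / b|) {u : ℚ}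
    (hu : SignType.sign u = SignType.sign (a + θ * b)) {τ : ℚ}
    (hτ : SignType.sign τ = SignType.sign (-θ)) :
    SignType.sign (if u = 0 then τ * b else u) = SignType.sign a := by
  have hu0 : u = 0 ↔ a + θ * b = 0 := by rw [← sign_eq_zero_iff, hu, sign_eq_zero_iff]
  split_ifs with h
  · rw [sign_mul, hτ, ← sign_mul]
    congr 1
    linarith [hu0.1 h]
  · rw [hu]
    have h' : a + θ * b ≠ 0 := fun hh => h (hu0.2 hh)
    rcases eq_or_ne b 0 with rfl | hb
    · simp
    have h1 := hθ hb
    have e : a = (a / b) * b := by field_simp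
    set y := a / b with hy
    have e2 : a + θ * b = (y + θ) * b := by rw [e]; ring
    rw [e2, e, sign_mul, sign_mul]
    congr 1
    have h2 : y + θ ≠ 0 := fun hh => h' (by rw [e2, hh, zero_mul])
    rcases lt_trichotomy y 0 with hy0 | hy0 | hy0
    · rw [sign_neg hy0, sign_neg]
      rw [abs_of_neg hy0, abs_le] at h1
      exact lt_of_le_of_ne (by linarith [h1.2]) h2
    · rw [hy0, abs_zero] at h1
      rw [hy0, abs_nonpos_iff.1 h1]; simp
    · rw [sign_pos hy0, sign_pos]
      rw [abs_of_pos hy0, abs_le] at h1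
      exact lt_of_le_of_ne (by linarith [h1.1]) h2.symm

theorem exists_sign_nat (θ : ℚ) : ∃ m : ℕ, m < 3 ∧ SignType.sign ((m : ℚ) - 1) = SignType.sign θ := by
  rcases lt_trichotomy θ 0 with h | h | h
  · exact ⟨0, by norm_num, by rw [sign_neg h, sign_neg]; norm_num⟩
  · exact ⟨1, by norm_num, by simp [h]⟩
  · exact ⟨2, by norm_num, by rw [sign_pos h, sign_pos]; norm_num⟩

/-- The sign pattern of every linear functional on a finite set of points is described by pivot
points and signs. -/
theorem exists_pat {n d : ℕ} (hn : 0 < n) (w : Fin n → Fin d → ℚ) (c : Fin d → ℚ) :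
    ∃ (κ : Fin d → Fin n) (m : Fin d → ℕ), (∀ i, m i < 3) ∧
      ∀ l, SignType.sign (pat (w l) (fun i => w (κ i)) fun i => (m i : ℚ) - 1) =
        SignType.sign (∑ i, c i * w l i) := by
  induction d with
  | zero => exact ⟨Fin.elim0, Fin.elim0, fun i => i.elim0, fun l => by simp [pat]⟩
  | succ d ih =>
    -- Shift the first coefficient by the θ of least absolute value that makes the functional vanish
    -- at a point with nonzero first coordinate; that point is the pivot. If all first coordinates
    -- are zero, θ = 0 and any point serves.
    obtain ⟨k, θ, hk, hθ⟩ : ∃ (k : Fin n) (θ : ℚ),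
        (w k 0 ≠ 0 → ∑ i, c i * w k i + θ * w k 0 = 0) ∧
        (w k 0 = 0 → ∀ l, w l 0 = 0) ∧
        ∀ l, w l 0 ≠ 0 → |θ| ≤ |(∑ i, c i * w l i) / w l 0| := by
      by_cases h : ∃ l, w l 0 ≠ 0
      · obtain ⟨k, hk, hmin⟩ := Finset.exists_min_image (Finset.univ.filter fun l => w l 0 ≠ 0)
          (fun l => |(∑ i, c i * w l i) / w l 0|) (by
            obtain ⟨l, hl⟩ := h; exact ⟨l, by simpa using hl⟩)
        simp only [Finset.mem_filter, Finset.mem_univ, true_and] at hk hmin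
        refine ⟨k, -((∑ i, c i * w k i) / w k 0), fun _ => ?_, fun h0 => absurd h0 hk, fun l hl => ?_⟩
        · field_simp; ring
        · rw [abs_neg]; exact hmin l hl
      · push Not at h
        exact ⟨⟨0, hn⟩, 0, fun h0 => absurd (h _) h0, fun _ => h, fun l hl => absurd (h l) hl⟩
    obtain ⟨κ, m, hm, hsign⟩ := ih (fun l => elim (w k) (w l)) fun i => c i.succ
    obtain ⟨m₀, hm₀, hs₀⟩ := exists_sign_nat (-θ)
    refine ⟨Fin.cons k κ, Fin.cons m₀ m, fun i => Fin.cases hm₀ hm i, fun l => ?_⟩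
    -- The shifted functional vanishes at the pivot, so it factors through the elimination of the
    -- first coordinate. In the degenerate case the quotient in `elim` is 0 and only a zero
    -- coordinate is dropped.
    have hval : ∑ i : Fin d, c i.succ * elim (w k) (w l) i = ∑ i, c i * w l i + θ * w l 0 := by
      have hel : ∑ i : Fin d, c i.succ * elim (w k) (w l) i =
          ∑ i : Fin d, c i.succ * w l i.succ - w l 0 / w k 0 * ∑ i : Fin d, c i.succ * w k i.succ := by
        rw [Finset.mul_sum, ← Finset.sum_sub_distrib]
        exact Finset.sum_congr rfl fun i _ => by simp only [elim]; ring
      rw [hel, Fin.sum_univ_succ]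
      by_cases h0 : w k 0 = 0
      · simp [hθ.1 h0 l, h0]
      · have := hk h0
        rw [Fin.sum_univ_succ] at this
        have h3 : ∑ i : Fin d, c i.succ * w k i.succ = -(c 0 + θ) * w k 0 := by linarith
        rw [h3]
        field_simp
        ring
    have := sign_shift (a := ∑ i, c i * w l i) (b := w l 0) (hθ.2 l) ((hsign l).trans (by rw [hval])) hs₀
    simpa only [pat, Fin.cons_zero, Fin.cons_succ] using this

/-! ### Types of rows -/

/-- Types of rows: which of the `t` binary vectors contain a one in a given position. -/
abbrev Ty (t : ℕ) : Type := Fin t → Bool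

open Classical in
/-- Sequential selection of a minimal type with respect to a strict comparison. -/
noncomputable def minTy {t : ℕ} (lt : Ty t → Ty t → Prop) : Ty t :=
  (Finset.univ : Finset (Ty t)).toList.foldl (fun y y' => if lt y' y then y' else y) fun _ => false

open Classical in
theorem minTy_le {t : ℕ} (f : Ty t → ℚ) (y : Ty t) : f (minTy fun y y' => f y < f y') ≤ f y := by
  have H : ∀ (l : List (Ty t)) (y₀ : Ty t),
      f (l.foldl (fun y y' => if f y' < f y then y' else y) y₀) ≤ f y₀ ∧
      ∀ y ∈ l, f (l.foldl (fun y y' => if f y' < f y then y' else y) y₀) ≤ f y := by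
    intro l
    induction l with
    | nil => simp
    | cons a l ih =>
      intro y₀
      rw [List.foldl_cons]
      obtain ⟨h1, h2⟩ := ih (if f a < f y₀ then a else y₀)
      have h3 : f (if f a < f y₀ then a else y₀) ≤ f y₀ ∧ f (if f a < f y₀ then a else y₀) ≤ f a := by
        split_ifs with h
        · exact ⟨h.le, le_rfl⟩
        · exact ⟨le_rfl, not_lt.1 h⟩
      refine ⟨h1.trans h3.1, fun y hy => ?_⟩
      rcases List.mem_cons.1 hy with rfl | hy
      · exact h1.trans h3.2
      · exact h2 y hy
  unfold minTy
  convert (H Finset.univ.toList fun _ => false).2 y (by simp) using 3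
  funext y y'
  congr

open Classical in
/-- The type `y` with `eq y` if there is one, otherwise a minimal type. -/
noncomputable def chooseTy {t : ℕ} (eq : Ty t → Prop) (lt : Ty t → Ty t → Prop) : Ty t :=
  if h : ∃ y, eq y then h.choose else minTy lt

/-- Names of the indices by which a candidate for one factor is described: a representative for
each type, and for each pair of types pivot points and signs. -/
abbrev Guess (t q : ℕ) : Type := Ty t ⊕ (Ty t × Ty t × Fin (q + 1) × Bool)

/-- A vector with a leading one. -/
def lift {q : ℕ} (v : Fin q → ℚ) : Fin (q + 1) → ℚ := Fin.cons 1 v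

/-- The type of row `k` in the candidate described by `g`, where `w` contains the rows of the
input and `P` the positions. -/
noncomputable def rowTy {t q : ℕ} (w : ℕ → Fin q → ℚ) (P : ℕ → ℚ) (g : Guess t q → ℕ) (k : ℕ) : Ty t :=
  chooseTy (fun y => P k = P (g (.inl y))) fun y y' =>
    pat (lift (w k)) (fun i => lift (w (g (.inr (y, y', i, true)))))
      (fun i => P (g (.inr (y, y', i, false))) - 1) < 0

/-- The machine's list of positions is known only below dim + 3; the row and the guessed indices are
the only places where it is read. -/
theorem rowTy_congr {t q : ℕ} (w : ℕ → Fin q → ℚ) {P P' : ℕ → ℚ} {g : Guess t q → ℕ} {k : ℕ}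
    (hk : P k = P' k) (hg : ∀ e, P (g e) = P' (g e)) : rowTy w P g k = rowTy w P' g k := by
  simp only [rowTy, hk, hg]

/-- Representatives keep their type under z, so no type of z is lost; every other row takes a
cheapest type, found from the guessed sign patterns of the cost differences. The first effect
preserves feasibility, the second does not increase the cost. -/
theorem exists_rowTy {t q n : ℕ} (hn : 0 < n) (w : ℕ → Fin q → ℚ) (z : Fin n → Ty t)
    (cost : (Fin q → ℚ) → Ty t → ℚ)
    (hcost : ∀ y y', ∃ c : Fin (q + 1) → ℚ, ∀ v, cost v y - cost v y' = ∑ i, c i * lift v i) :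
    ∃ g : Guess t q → ℕ, (∀ e, g e < n + 3) ∧
      (∀ k, ∃ k' : Fin n, rowTy w (fun k => (k : ℚ)) g k' = z k) ∧
      ∀ k : Fin n, cost (w k) (rowTy w (fun k => (k : ℚ)) g k) ≤ cost (w k) (z k) := by
  classical
  choose c hc using hcost
  choose κ m hm hs using fun y y' => exists_pat hn (fun l : Fin n => lift (w l)) (c y y')
  -- The value n is not a row and marks a type without representative. Signs are coded as 0, 1, 2,
  -- so n + 3 bounds all three kinds of index.
  let g : Guess t q → ℕ := Sum.elim
    (fun y => if h : ∃ k, z k = y then h.choose else n)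
    fun e => if e.2.2.2 then κ e.1 e.2.1 e.2.2.1 else m e.1 e.2.1 e.2.2.1
  have hrep : ∀ (y : Ty t) (k : Fin n), (k : ℕ) = g (.inl y) → z k = y := by
    intro y k hk
    simp only [g, Sum.elim_inl] at hk
    split_ifs at hk with h
    · rw [Fin.ext hk]; exact h.choose_spec
    · exact absurd hk k.2.ne
  have hlt : ∀ (y y' : Ty t) (k : Fin n),
      pat (lift (w k)) (fun i => lift (w (g (.inr (y, y', i, true)))))
        (fun i => ((g (.inr (y, y', i, false)) : ℕ) : ℚ) - 1) < 0 ↔ cost (w k) y < cost (w k) y' := by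
    intro y y' k
    have h1 := hs y y' k
    rw [← hc y y' (w k)] at h1
    rw [← sub_neg (a := cost (w k) y), ← sign_eq_neg_one_iff, ← sign_eq_neg_one_iff, ← h1]
    simp [g]
  have hrow : ∀ k : Fin n, (∃ y, (k : ℕ) = g (.inl y)) →
      rowTy w (fun k => (k : ℚ)) g k = z k := by
    intro k hk
    have hk' : ∃ y, ((k : ℕ) : ℚ) = g (.inl y) := by exact_mod_cast hk
    rw [rowTy, chooseTy, dif_pos hk']
    exact (hrep _ k (by exact_mod_cast hk'.choose_spec)).symm
  refine ⟨g, ?_, ?_, ?_⟩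
  · rintro (y | ⟨y, y', i, b⟩)
    · simp only [g, Sum.elim_inl]
      split_ifs with h
      · exact h.choose.2.trans (by omega)
      · omega
    · simp only [g, Sum.elim_inr]
      split_ifs
      · exact (κ y y' i).2.trans (by omega)
      · exact (hm y y' i).trans_le (by omega)
  · intro k
    have h : ∃ k', z k' = z k := ⟨k, rfl⟩
    refine ⟨h.choose, (hrow _ ⟨z k, ?_⟩).trans h.choose_spec⟩
    simp only [g, Sum.elim_inl]
    rw [dif_pos h]
  · intro k
    by_cases hk : ∃ y, (k : ℕ) = g (.inl y)
    · rw [hrow k hk]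
    · have hk' : ¬ ∃ y, ((k : ℕ) : ℚ) = g (.inl y) := by exact_mod_cast hk
      rw [rowTy, chooseTy, dif_neg hk']
      simp only [hlt]
      exact minTy_le _ _

/-! ### Binary tensors given by row types -/

variable {s t q : ℕ}

/-- The number `0` or `1` that corresponds to a truth value. -/
def bit (b : Bool) : ℚ := if b then 1 else 0

theorem ht_bit (b : Bool) : StronglyPoly.ht (bit b) = 1 := by cases b <;> simp [bit]

/-- The binary vectors with the given row types. -/
def vec {n : Fin s → ℕ} (z : ∀ j, Fin (n j) → Ty t) : Fin t → Vectors n :=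
  fun i j k => bit (z j k i)

def approx {n : Fin s → ℕ} (z : ∀ j, Fin (n j) → Ty t) : Tensor n := ∑ i, outer (vec z i)

theorem isBinary_vec {n : Fin s → ℕ} (z : ∀ j, Fin (n j) → Ty t) (i : Fin t) :
    IsBinary (vec z i) := by
  intro j k
  unfold vec bit
  split_ifs <;> simp

/-- The tensor with the row types `z` has an admissible binary rank. -/
def Feasible (rk : ℕ → Prop) {n : Fin s → ℕ} (z : ∀ j, Fin (n j) → Ty t) : Prop :=
  ∃ r, HasBinaryRank (approx z) r ∧ rk r

theorem exists_hasBinaryRank {n : Fin s → ℕ} (z : ∀ j, Fin (n j) → Ty t) :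
    ∃ r ≤ t, HasBinaryRank (approx z) r := by
  classical
  have h : ∃ m, ∃ c : Fin m → Vectors n, (∀ i, IsBinary (c i)) ∧ approx z = ∑ i, outer (c i) :=
    ⟨t, vec z, isBinary_vec z, rfl⟩
  exact ⟨Nat.find h, Nat.find_min' h ⟨vec z, isBinary_vec z, rfl⟩, Nat.find_spec h,
    fun m hm => Nat.find_min' h hm⟩

/-- If every type of z occurs in z', the tensor of z arises from that of z' by selecting and
repeating slices. The same selection applied to the vectors of a binary factorization gives one with
equally many terms. -/
theorem binaryRank_le {n n' : Fin s → ℕ} {z : ∀ j, Fin (n j) → Ty t}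
    {z' : ∀ j, Fin (n' j) → Ty t} (h : ∀ j k, ∃ k', z' j k' = z j k) {r r' : ℕ}
    (hr : HasBinaryRank (approx z) r) (hr' : HasBinaryRank (approx z') r') : r ≤ r' := by
  choose φ hφ using h
  obtain ⟨c, hc, hcz⟩ := hr'.1
  refine hr.2 ⟨fun i j k => c i j (φ j k), fun i j k => hc i j _, ?_⟩
  funext κ
  have := congrFun hcz fun j => φ j (κ j)
  simpa [approx, Finset.sum_apply, outer, vec, hφ] using this

/-- The conditions on the binary rank that are considered: an upward closed set of numbers up
to `t` that contains `t`. -/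
structure RankCondition (t : ℕ) (rk : ℕ → Prop) : Prop where
  le : ∀ r, rk r → r ≤ t
  mono : ∀ r r', rk r → r ≤ r' → r' ≤ t → rk r'
  self : rk t

theorem Feasible.mono {rk : ℕ → Prop} (hrk : RankCondition t rk) {n n' : Fin s → ℕ}
    {z : ∀ j, Fin (n j) → Ty t} {z' : ∀ j, Fin (n' j) → Ty t}
    (h : ∀ j k, ∃ k', z' j k' = z j k) (hz : Feasible rk z) : Feasible rk z' := by
  obtain ⟨r, hr, hrk'⟩ := hz
  obtain ⟨r', hr't, hr'⟩ := exists_hasBinaryRank z'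
  exact ⟨r', hr', hrk.mono r r' hrk' (binaryRank_le h hr hr') hr't⟩

/-- Take t equal terms supported at a single position. The entry there is t, while a binary outer
product contributes at most 1 to it, so the binary rank is exactly t. -/
theorem exists_feasible {rk : ℕ → Prop} (hrk : RankCondition t rk) {n : Fin s → ℕ}
    (hn : ∀ j, 0 < n j) : ∃ z : ∀ j, Fin (n j) → Ty t, Feasible rk z := by
  refine ⟨fun j k i => decide (k = ⟨0, hn j⟩), t, ?_, hrk.self⟩
  refine ⟨⟨_, isBinary_vec _, rfl⟩, ?_⟩
  rintro m ⟨c, hc, hcz⟩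
  have h := congrFun hcz fun j => ⟨0, hn j⟩
  simp only [approx, Finset.sum_apply, outer, vec, bit] at h
  have h1 : ∀ i, ∏ j, c i j ⟨0, hn j⟩ ≤ 1 := fun i =>
    Finset.prod_le_one (fun j _ => by rcases hc i j ⟨0, hn j⟩ with h | h <;> simp [h])
      fun j _ => by rcases hc i j ⟨0, hn j⟩ with h | h <;> simp [h]
  have h2 := Finset.sum_le_sum fun i (_ : i ∈ (Finset.univ : Finset (Fin m))) => h1 i
  rw [← h] at h2
  simpa using h2

/-- Pad with zero vectors. The added outer products vanish because s > 0 makes the product over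
factors nonempty. -/
theorem exists_approx_eq (hs : 0 < s) {n : Fin s → ℕ} {B : Tensor n} {r : ℕ}
    (hB : HasBinaryRank B r) (hr : r ≤ t) : ∃ z : ∀ j, Fin (n j) → Ty t, approx z = B := by
  classical
  obtain ⟨c, hc, rfl⟩ := hB.1
  refine ⟨fun j k i => if h : (i : ℕ) < r then decide (c ⟨i, h⟩ j k = 1) else false, ?_⟩
  obtain ⟨m, rfl⟩ := Nat.exists_eq_add_of_le hr
  have hj : (⟨0, hs⟩ : Fin s) ∈ Finset.univ := Finset.mem_univ _
  unfold approx
  rw [Fin.sum_univ_add]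
  have h2 : ∀ i : Fin m, outer (vec (fun (j : Fin s) (k : Fin (n j)) (i : Fin (r + m)) =>
      if h : (i : ℕ) < r then decide (c ⟨i, h⟩ j k = 1) else false) (Fin.natAdd r i)) = 0 := by
    intro i
    funext κ
    exact Finset.prod_eq_zero hj (by simp [vec, bit])
  rw [Finset.sum_eq_zero fun i _ => h2 i, add_zero]
  refine Finset.sum_congr rfl fun i _ => ?_
  funext κ
  refine Finset.prod_congr rfl fun j _ => ?_
  rcases hc i j (κ j) with h | h <;> simp [vec, bit, h]

/-- `z` describes a best approximation. -/
def Optimal (rk : ℕ → Prop) (I : Inst s q) (z : ∀ j, Fin (I.n j) → Ty t) : Prop :=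
  Feasible rk z ∧ ∀ z' : ∀ j, Fin (I.n j) → Ty t, Feasible rk z' →
    sqDist I.tensor (approx z) ≤ sqDist I.tensor (approx z')

theorem exists_optimal {rk : ℕ → Prop} (hrk : RankCondition t rk) (I : Inst s q) :
    ∃ z : ∀ j, Fin (I.n j) → Ty t, Optimal rk I z := by
  classical
  obtain ⟨z₀, h₀⟩ := exists_feasible hrk I.n_pos
  obtain ⟨z, hz, hmin⟩ := Finset.exists_min_image
    (Finset.univ.filter fun z : ∀ j, Fin (I.n j) → Ty t => Feasible rk z)
    (fun z => sqDist I.tensor (approx z)) ⟨z₀, by simpa using h₀⟩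
  exact ⟨z, by simpa using hz, fun z' hz' => hmin z' (by simpa using hz')⟩

theorem Optimal.isBest (hs : 0 < s) {rk : ℕ → Prop} (hrk : RankCondition t rk) {I : Inst s q}
    {z : ∀ j, Fin (I.n j) → Ty t} (hz : Optimal rk I z) :
    IsBest (fun B => ∃ r, HasBinaryRank B r ∧ rk r) I.tensor (approx z) := by
  refine ⟨hz.1, ?_⟩
  rintro B ⟨r, hB, hr⟩
  obtain ⟨z', rfl⟩ := exists_approx_eq hs hB (hrk.le r hr)
  exact hz.2 z' ⟨r, hB, hr⟩

/-! ### Optimization of one factor -/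

/-- The part of the objective function that belongs to a row of factor `j` with input
entries `v` and type `y`. -/
def rowCost (I : Inst s q) (z : ∀ j, Fin (I.n j) → Ty t) (j : Fin s) (v : Fin q → ℚ) (y : Ty t) : ℚ :=
  ∑ κ : (∀ j' : {j' // j' ≠ j}, Fin (I.n j')),
    (∑ p, v p * ∏ j' : {j' // j' ≠ j}, I.a p j' (κ j') - ∑ i, bit (y i) * ∏ j' : {j' // j' ≠ j}, vec z i j' (κ j')) ^ 2

/-- The part of the cost that is quadratic in v does not involve the type and cancels. The leading
one in `lift` carries the constant term. -/
theorem rowCost_sub (I : Inst s q) (z : ∀ j, Fin (I.n j) → Ty t) (j : Fin s) (y y' : Ty t) :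
    ∃ c : Fin (q + 1) → ℚ, ∀ v, rowCost I z j v y - rowCost I z j v y' = ∑ i, c i * lift v i := by
  let β : Ty t → (∀ j' : {j' // j' ≠ j}, Fin (I.n j')) → ℚ := fun y κ =>
    ∑ i, bit (y i) * ∏ j' : {j' // j' ≠ j}, vec z i j' (κ j')
  refine ⟨Fin.cons (∑ κ, (β y κ ^ 2 - β y' κ ^ 2)) fun p =>
    ∑ κ, -2 * (∏ j' : {j' // j' ≠ j}, I.a p j' (κ j')) * (β y κ - β y' κ), fun v => ?_⟩
  rw [Fin.sum_univ_succ]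
  simp only [lift, Fin.cons_zero, Fin.cons_succ, mul_one, Finset.sum_mul]
  rw [Finset.sum_comm, ← Finset.sum_add_distrib, rowCost, rowCost, ← Finset.sum_sub_distrib]
  refine Finset.sum_congr rfl fun κ _ => ?_
  have : ∑ p, -2 * (∏ j' : {j' // j' ≠ j}, I.a p j' (κ j')) * (β y κ - β y' κ) * v p =
      -2 * (β y κ - β y' κ) * ∑ p, v p * ∏ j' : {j' // j' ≠ j}, I.a p j' (κ j') := by
    rw [Finset.mul_sum]
    exact Finset.sum_congr rfl fun p _ => by ring
  rw [this]
  simp only [β]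
  ring

/-- Split a position into its j-th coordinate and the rest. Since `rowCost` ignores z j, the rows of
factor j can be optimized independently. -/
theorem sqDist_update (I : Inst s q) (z : ∀ j, Fin (I.n j) → Ty t) (j : Fin s)
    (f : Fin (I.n j) → Ty t) :
    sqDist I.tensor (approx (Function.update z j f)) =
      ∑ k, rowCost I z j (fun p => I.a p j k) (f k) := by
  unfold sqDist rowCost
  rw [← (Equiv.piSplitAt j fun j => Fin (I.n j)).symm.sum_comp, Fintype.sum_prod_type]
  refine Finset.sum_congr rfl fun k _ => Finset.sum_congr rfl fun κ _ => ?_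
  have hsplit : ∀ c : Vectors I.n, outer c ((Equiv.piSplitAt j fun j => Fin (I.n j)).symm (k, κ)) =
      c j k * ∏ j' : {j' // j' ≠ j}, c j' (κ j') := by
    intro c
    unfold outer
    rw [Fintype.prod_eq_mul_prod_subtype_ne _ j]
    congr 1
    · simp [Equiv.piSplitAt]
    · refine Finset.prod_congr rfl fun j' _ => ?_
      simp [Equiv.piSplitAt, j'.2]
  simp only [Inst.tensor, approx, Finset.sum_apply, hsplit]
  congr 2
  refine Finset.sum_congr rfl fun i _ => ?_
  congr 1
  · simp [vec]
  · refine Finset.prod_congr rfl fun j' _ => ?_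
    simp [vec, j'.2]

/-- Row `k` of factor `j` of the input, with zeros outside of the range. -/
def Inst.row (I : Inst s q) (j : Fin s) (k : ℕ) (p : Fin q) : ℚ :=
  if h : k < I.n j then I.a p j ⟨k, h⟩ else 0

/-- The candidate described by `g`. -/
noncomputable def cand (I : Inst s q) (g : Fin s → Guess t q → ℕ) : ∀ j, Fin (I.n j) → Ty t :=
  fun j k => rowTy (I.row j) (fun k => (k : ℚ)) (g j) k

theorem exists_optimal_cand {rk : ℕ → Prop} (hrk : RankCondition t rk) (I : Inst s q) :
    ∃ g : Fin s → Guess t q → ℕ, (∀ j e, g j e < I.dim + 3) ∧ Optimal rk I (cand I g) := by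
  classical
  -- Factors already replaced stay described by their guesses, because a candidate factor depends on
  -- the input and its own guess but not on the current z.
  have H : ∀ J : Finset (Fin s), ∃ (g : Fin s → Guess t q → ℕ) (z : ∀ j, Fin (I.n j) → Ty t),
      (∀ j e, g j e < I.dim + 3) ∧ Optimal rk I z ∧ ∀ j ∈ J, z j = cand I g j := by
    intro J
    induction J using Finset.induction_on with
    | empty =>
      obtain ⟨z, hz⟩ := exists_optimal hrk I
      exact ⟨fun _ _ => 0, z, by simp, hz, by simp⟩
    | insert j J hj ih =>
      obtain ⟨g, z, hg, hz, hJ⟩ := ih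
      obtain ⟨gj, h1, h2, h3⟩ := exists_rowTy (I.n_pos j) (I.row j) (z j) (rowCost I z j)
        (rowCost_sub I z j)
      set f : Fin (I.n j) → Ty t := fun k => rowTy (I.row j) (fun k => (k : ℚ)) gj k with hf
      have hrow : ∀ k : Fin (I.n j), I.row j k = fun p => I.a p j k := fun k => by
        funext p; simp [Inst.row]
      have hle : sqDist I.tensor (approx (Function.update z j f)) ≤ sqDist I.tensor (approx z) := by
        conv_rhs => rw [← Function.update_eq_self j z]
        rw [sqDist_update, sqDist_update]
        refine Finset.sum_le_sum fun k _ => ?_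
        rw [← hrow]
        exact h3 k
      have hfeas : Feasible rk (Function.update z j f) := by
        refine hz.1.mono hrk fun j' k => ?_
        by_cases hj' : j' = j
        · subst hj'
          simpa using h2 k
        · exact ⟨k, by rw [Function.update_of_ne hj']⟩
      refine ⟨Function.update g j gj, Function.update z j f, fun j' e => ?_, ⟨hfeas, fun z' hz' =>
        hle.trans (hz.2 z' hz')⟩, fun j' hj' => ?_⟩
      · by_cases hj' : j' = j
        · subst hj'
          rw [Function.update_self]
          refine (h1 e).trans_le (Nat.add_le_add_right ?_ 3)
          exact Finset.single_le_sum (f := I.n) (fun _ _ => Nat.zero_le _) (Finset.mem_univ _)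
        · rw [Function.update_of_ne hj']
          exact hg j' e
      · by_cases h : j' = j
        · subst h
          rw [Function.update_self]
          funext k
          simp [cand, hf]
        · rw [Function.update_of_ne h, hJ j' ((Finset.mem_insert.1 hj').resolve_left h)]
          funext k
          simp [cand, h]
  obtain ⟨g, z, hg, hz, h⟩ := H Finset.univ
  refine ⟨g, hg, ?_⟩
  rwa [← show z = cand I g from funext fun j => h j (Finset.mem_univ _)]

end BTF

/-! ### Memory layout and expressibility of the quantities to be computed. -/

namespace BTF

open StronglyPoly

/-! ### Memory layout -/

section Layout

variable (s t q : ℕ)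

/-- Names of the arrays: input arrays, which are also used for the output, single arrays, one
flag for each factor and type, and copies of the output arrays. -/
abbrev Cells : Type := (Fin (q + t) × Fin s) ⊕ (Fin 6 ⊕ (Fin s × Ty t) ⊕ (Fin t × Fin s))

/-- The number of the array with a given name. -/
noncomputable def code : Cells s t q → ℕ :=
  Sum.elim (fun e => e.1 * s + e.2) fun a => (q + t) * s + Fintype.equivFin _ a

theorem code_injective : (code s t q).Injective := by
  have h1 : ∀ e : Fin (q + t) × Fin s, (e.1 : ℕ) * s + e.2 = finProdFinEquiv e := fun e => by
    simp [finProdFinEquiv]; ring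
  rintro (e | a) (e' | a') h
  · simp only [code, Sum.elim_inl, h1] at h
    rw [finProdFinEquiv.injective (Fin.ext h)]
  · simp only [code, Sum.elim_inl, Sum.elim_inr, h1] at h
    have := (finProdFinEquiv e).2
    omega
  · simp only [code, Sum.elim_inl, Sum.elim_inr, h1] at h
    have := (finProdFinEquiv e').2
    omega
  · simp only [code, Sum.elim_inr, Nat.add_left_cancel_iff] at h
    rw [(Fintype.equivFin _).injective (Fin.ext h)]

theorem exists_code_lt : ∃ b, ∀ v, code s t q v < b := by
  obtain ⟨b, hb⟩ := (Set.finite_range (code s t q)).bddAbove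
  exact ⟨b + 1, fun v => Nat.lt_succ_of_le (hb ⟨v, rfl⟩)⟩

variable {s t q}

abbrev inp (p : Fin (q + t)) (j : Fin s) : Cells s t q := .inl (p, j)
abbrev pos : Cells s t q := .inr (.inl 0)
abbrev ctr : Cells s t q := .inr (.inl 1)
abbrev acc : Cells s t q := .inr (.inl 2)
abbrev best : Cells s t q := .inr (.inl 3)
abbrev found : Cells s t q := .inr (.inl 4)
abbrev upd : Cells s t q := .inr (.inl 5)
abbrev flag (e : Fin s × Ty t) : Cells s t q := .inr (.inr (.inl e))
abbrev outv (e : Fin t × Fin s) : Cells s t q := .inr (.inr (.inr e))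

/-- The register that counts the position in factor `j`. -/
def kReg (j : Fin s) : ℕ := s + 3 + j

/-- The register for an index of the description of a candidate. -/
noncomputable def gReg (e : Fin s × Guess t q) : ℕ := 2 * s + 3 + Fintype.equivFin _ e

theorem kReg_injective : (kReg (s := s)).Injective := fun j j' h => by
  apply Fin.ext; simp only [kReg] at h; omega

theorem gReg_injective : (gReg (s := s) (t := t) (q := q)).Injective := fun e e' h => by
  simp only [gReg, Nat.add_left_cancel_iff] at h
  exact (Fintype.equivFin _).injective (Fin.ext h)

theorem kReg_ne_gReg (j : Fin s) (e : Fin s × Guess t q) : kReg j ≠ gReg e := by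
  simp only [kReg, gReg]; omega

variable (s t q)

/-- Input register j already holds n j and serves as the bound. -/
def kLoops : List (ℕ × ℕ) := (List.finRange s).map fun j => (kReg j, (j : ℕ))

noncomputable def gLoops : List (ℕ × ℕ) :=
  (Finset.univ : Finset (Fin s × Guess t q)).toList.map fun e => (gReg e, s + 2)

variable {s t q}

/-- The register contents outside of all loops. -/
def Inst.regs (I : Inst s q) (r : ℕ) : ℕ :=
  if h : r < s then I.n ⟨r, h⟩ else if r = s + 1 then 1 else if r = s + 2 then I.dim + 3 else 0

/-- Register contents in which the registers `0, …, s + 2` have their standard values. -/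
structure IsEnv (I : Inst s q) (ρ : ℕ → ℕ) : Prop where
  dim : ∀ j : Fin s, ρ j = I.n j
  zero : ρ s = 0
  one : ρ (s + 1) = 1
  bound : ρ (s + 2) = I.dim + 3

theorem Inst.n_le_dim (I : Inst s q) (j : Fin s) : I.n j ≤ I.dim :=
  Finset.single_le_sum (f := I.n) (fun _ _ => Nat.zero_le _) (Finset.mem_univ _)

theorem Inst.isEnv_regs (I : Inst s q) : IsEnv I I.regs := by
  refine ⟨fun j => ?_, ?_, ?_, ?_⟩ <;> simp [Inst.regs]

theorem Inst.regs_kReg (I : Inst s q) (j : Fin s) : I.regs (kReg j) = 0 := by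
  have h1 : ¬ s + 3 + j < s := by omega
  have h2 : s + 3 + (j : ℕ) ≠ s + 1 := by omega
  have h3 : s + 3 + (j : ℕ) ≠ s + 2 := by omega
  simp only [Inst.regs, kReg, h1, h2, h3, dite_false, if_false]

theorem IsEnv.loopRegs_k {I : Inst s q} {ρ : ℕ → ℕ} (h : IsEnv I ρ)
    (hk : ∀ j : Fin s, ρ (kReg j) = 0) : LoopRegs (s + 1) (I.dim + 3) (kLoops s) ρ := by
  refine ⟨?_, ?_, ?_, ?_, ?_, h.one⟩
  · rw [kLoops, List.map_map]
    exact (List.nodup_finRange s).map kReg_injective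
  all_goals simp only [kLoops, List.mem_map, List.mem_finRange, true_and, forall_exists_index,
    forall_apply_eq_imp_iff]
  · intro j j'; simp only [kReg]; omega
  · intro j; simp only [kReg]; omega
  · exact hk
  · intro j; rw [h.dim]; exact (I.n_le_dim j).trans (by omega)

theorem Inst.loopRegs_g (I : Inst s q) :
    LoopRegs (s + 1) (I.dim + 3) (gLoops s t q) I.regs := by
  refine ⟨?_, ?_, ?_, ?_, ?_, I.isEnv_regs.one⟩
  · rw [gLoops, List.map_map]
    exact (Finset.nodup_toList _).map gReg_injective
  all_goals simp only [gLoops, List.mem_map, Finset.mem_toList, Finset.mem_univ, true_and,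
    forall_exists_index, forall_apply_eq_imp_iff]
  · intro e e'; simp only [gReg]; omega
  · intro e; simp only [gReg]; omega
  · intro e
    generalize he : gReg e = r
    simp only [gReg] at he
    rw [Inst.regs, dif_neg (by omega), if_neg (by omega), if_neg (by omega)]
  · intro _; exact I.isEnv_regs.bound.le

/-- Register contents in the body of the loops over all candidates. -/
structure IsGuessEnv (t : ℕ) (I : Inst s q) (ρ : ℕ → ℕ) : Prop extends IsEnv I ρ where
  counter : ∀ j : Fin s, ρ (kReg j) = 0
  guess_lt : ∀ e : Fin s × Guess t q, ρ (gReg e) < I.dim + 3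

theorem Inst.isGuessEnv (I : Inst s q) {ρ : ℕ → ℕ} (h : ρ ∈ enum (gLoops s t q) I.regs) :
    IsGuessEnv t I ρ := by
  obtain ⟨h1, h2⟩ := (mem_enum I.loopRegs_g).1 h
  simp only [gLoops, List.mem_map, Finset.mem_toList, Finset.mem_univ, true_and,
    forall_exists_index, forall_apply_eq_imp_iff] at h1 h2
  have hE := I.isEnv_regs
  refine ⟨⟨fun j => ?_, ?_, ?_, ?_⟩, fun j => ?_, fun e => ?_⟩
  · rw [h2 j fun e => by simp only [gReg]; omega, hE.dim]
  · rw [h2 s fun e => by simp only [gReg]; omega, hE.zero]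
  · rw [h2 (s + 1) fun e => by simp only [gReg]; omega, hE.one]
  · rw [h2 (s + 2) fun e => by simp only [gReg]; omega, hE.bound]
  · rw [h2 _ fun e => (kReg_ne_gReg j e).symm, I.regs_kReg]
  · exact (h1 e).trans_eq hE.bound

theorem Inst.exists_mem_enum (I : Inst s q) (g : Fin s → Guess t q → ℕ)
    (hg : ∀ j e, g j e < I.dim + 3) :
    ∃ ρ ∈ enum (gLoops s t q) I.regs, ∀ j e, ρ (gReg (j, e)) = g j e := by
  classical
  refine ⟨fun r => if h : ∃ e : Fin s × Guess t q, gReg e = r then g h.choose.1 h.choose.2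
    else I.regs r, (mem_enum I.loopRegs_g).2 ?_, ?_⟩
  · simp only [gLoops, List.mem_map, Finset.mem_toList, Finset.mem_univ, true_and,
      forall_exists_index, forall_apply_eq_imp_iff]
    refine ⟨fun e => ?_, fun r hr => ?_⟩
    · rw [dif_pos ⟨e, rfl⟩, I.isEnv_regs.bound]
      exact hg _ _
    · rw [dif_neg (by push Not; exact hr)]
  · intro j e
    have h : ∃ e' : Fin s × Guess t q, gReg e' = gReg (j, e) := ⟨_, rfl⟩
    simp only [dif_pos h, gReg_injective h.choose_spec]

theorem IsEnv.mem_enum_k {I : Inst s q} {ρ ρ' : ℕ → ℕ} (h : IsEnv I ρ)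
    (hk : ∀ j : Fin s, ρ (kReg j) = 0) : ρ' ∈ enum (kLoops s) ρ ↔
      (∀ j : Fin s, ρ' (kReg j) < I.n j) ∧ ∀ r, (∀ j : Fin s, kReg j ≠ r) → ρ' r = ρ r := by
  rw [mem_enum (h.loopRegs_k hk)]
  simp only [kLoops, List.mem_map, List.mem_finRange, true_and, forall_exists_index,
    forall_apply_eq_imp_iff, h.dim]

open Classical in
/-- The register contents `ρ` with the positions `κ` in the counting registers. -/
noncomputable def setK (ρ : ℕ → ℕ) (κ : Fin s → ℕ) (r : ℕ) : ℕ :=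
  if h : ∃ j : Fin s, kReg j = r then κ h.choose else ρ r

theorem setK_kReg (ρ : ℕ → ℕ) (κ : Fin s → ℕ) (j : Fin s) : setK ρ κ (kReg j) = κ j := by
  have h : ∃ j' : Fin s, kReg j' = kReg j := ⟨j, rfl⟩
  rw [setK, dif_pos h, kReg_injective h.choose_spec]

theorem setK_of_ne (ρ : ℕ → ℕ) (κ : Fin s → ℕ) {r : ℕ} (h : ∀ j : Fin s, kReg j ≠ r) :
    setK ρ κ r = ρ r := by
  rw [setK, dif_neg (by push Not; exact h)]

theorem IsEnv.setK_mem {I : Inst s q} {ρ : ℕ → ℕ} (h : IsEnv I ρ)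
    (hk : ∀ j : Fin s, ρ (kReg j) = 0) (κ : ∀ j, Fin (I.n j)) :
    setK ρ (fun j => (κ j : ℕ)) ∈ enum (kLoops s) ρ :=
  (h.mem_enum_k hk).2 ⟨fun j => by rw [setK_kReg]; exact (κ j).2, fun _ hr => setK_of_ne _ _ hr⟩

theorem IsEnv.sum_enum_k {I : Inst s q} {ρ : ℕ → ℕ} (h : IsEnv I ρ)
    (hk : ∀ j : Fin s, ρ (kReg j) = 0) (F : (ℕ → ℕ) → ℚ) :
    ((enum (kLoops s) ρ).map F).sum = ∑ κ : ∀ j, Fin (I.n j), F (setK ρ fun j => (κ j : ℕ)) := by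
  classical
  rw [← List.sum_toFinset _ (nodup_enum (h.loopRegs_k hk))]
  symm
  refine Finset.sum_bij (fun κ _ => setK ρ fun j => (κ j : ℕ)) ?_ ?_ ?_ ?_
  · intro κ _
    exact List.mem_toFinset.2 (h.setK_mem hk κ)
  · intro κ _ κ' _ he
    funext j
    have := congrFun he (kReg j)
    rw [setK_kReg, setK_kReg] at this
    exact Fin.ext this
  · intro ρ' hρ'
    obtain ⟨h1, h2⟩ := (h.mem_enum_k hk).1 (List.mem_toFinset.1 hρ')
    refine ⟨fun j => ⟨ρ' (kReg j), h1 j⟩, Finset.mem_univ _, ?_⟩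
    funext r
    by_cases hr : ∃ j : Fin s, kReg j = r
    · obtain ⟨j, rfl⟩ := hr
      rw [setK_kReg]
    · push Not at hr
      rw [setK_of_ne _ _ hr, h2 r hr]
  · intros; rfl

end Layout

/-! ### Expressibility of the functions used by the algorithm -/

variable {s t q : ℕ}

/-- The recursion has fixed depth d, so it unfolds into one expression whose size does not depend on
the instance. -/
theorem expressible_pat {V : Type} {d : ℕ} {x : Fin d → Arrays V → (ℕ → ℕ) → ℚ}
    {pv : Fin d → Fin d → Arrays V → (ℕ → ℕ) → ℚ} {sg : Fin d → Arrays V → (ℕ → ℕ) → ℚ}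
    (hx : ∀ i, Expressible (x i)) (hp : ∀ i i', Expressible (pv i i'))
    (hs : ∀ i, Expressible (sg i)) :
    Expressible fun S ρ =>
      pat (fun i => x i S ρ) (fun i i' => pv i i' S ρ) (fun i => sg i S ρ) := by
  induction d with
  | zero => exact .const 0
  | succ d ih =>
    have hel : ∀ y : Fin (d + 1) → Arrays V → (ℕ → ℕ) → ℚ, (∀ i, Expressible (y i)) →
        ∀ i : Fin d, Expressible fun S ρ =>
          elim (fun i => pv 0 i S ρ) (fun i => y i S ρ) i := fun y hy i =>
      (hy i.succ).sub (((hy 0).div (hp 0 0)).mul (hp 0 i.succ))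
    have hu := ih (hel x hx) (fun i => hel (pv i.succ) (hp i.succ)) fun i => hs i.succ
    convert (hu.eq (.const 0)).ite ((hs 0).mul (hx 0)) hu using 3
    simp only [pat]

/-- The type of row `k` of factor `j` in the candidate described by the registers. -/
noncomputable def tyAt (S : Arrays (Cells s t q)) (ρ : ℕ → ℕ) (j : Fin s) (k : ℕ) : Ty t :=
  rowTy (fun k p => S (inp (p.castAdd t) j) k) (S pos) (fun e => ρ (gReg (j, e))) k

theorem expressible_tyAt (H : Ty t → ℚ) (j : Fin s) (r : ℕ) :
    Expressible fun (S : Arrays (Cells s t q)) ρ => H (tyAt S ρ j (ρ r)) := by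
  have hl : ∀ (r : ℕ) (i : Fin (q + 1)), Expressible fun (S : Arrays (Cells s t q)) ρ =>
      lift (fun p => S (inp (p.castAdd t) j) (ρ r)) i := by
    intro r i
    refine Fin.cases ?_ (fun p => ?_) i
    · simpa [lift] using Expressible.const 1
    · simpa [lift] using Expressible.var (inp (p.castAdd t) j) r
  have hp : ∀ r : ℕ, Expressible fun (S : Arrays (Cells s t q)) ρ => S pos (ρ r) :=
    fun r => .var pos r
  -- The type of a row is a function of 2^t + 4^t truth values: whether the row represents a given
  -- type, and the outcome of each pairwise cost comparison.
  exact Expressible.table (B := Ty t ⊕ (Ty t × Ty t))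
    (fun b => H (chooseTy (fun y => b (.inl y)) fun y y' => b (.inr (y, y'))))
    (P := Sum.elim (fun y S ρ => S pos (ρ r) = S pos (ρ (gReg (j, .inl y))))
      fun e S ρ => pat (lift fun p => S (inp (p.castAdd t) j) (ρ r))
        (fun i => lift fun p => S (inp (p.castAdd t) j) (ρ (gReg (j, .inr (e.1, e.2, i, true)))))
        (fun i => S pos (ρ (gReg (j, .inr (e.1, e.2, i, false)))) - 1) < 0)
    (by
      rintro (y | e)
      · exact (hp r).eq (hp _)
      · exact (expressible_pat (hl r) (fun i => hl _) fun i => (hp _).sub (.const 1)).lt (.const 0))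

theorem tyAt_congr {S S' : Arrays (Cells s t q)} (hi : ∀ p j, S (inp p j) = S' (inp p j))
    (hp : S pos = S' pos) (ρ : ℕ → ℕ) (j : Fin s) (k : ℕ) : tyAt S ρ j k = tyAt S' ρ j k := by
  simp only [tyAt, hi, hp]

/-- The contribution of one position to the objective function. -/
noncomputable def term (S : Arrays (Cells s t q)) (ρ : ℕ → ℕ) : ℚ :=
  (∑ p : Fin q, ∏ j, S (inp (p.castAdd t) j) (ρ (kReg j)) -
    ∑ i, ∏ j, bit (tyAt S ρ j (ρ (kReg j)) i)) ^ 2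

theorem expressible_term : Expressible (term (s := s) (t := t) (q := q)) := by
  have h : Expressible fun (S : Arrays (Cells s t q)) ρ =>
      (∑ p : Fin q, ∏ j, S (inp (p.castAdd t) j) (ρ (kReg j))) -
        ∑ i, ∏ j, bit (tyAt S ρ j (ρ (kReg j)) i) :=
    (Expressible.sum _ fun p => Expressible.prod _ fun j => .var _ _).sub
      (Expressible.sum _ fun i => Expressible.prod _ fun j =>
        expressible_tyAt (fun y => bit (y i)) j _)
  convert h.mul h using 3
  rw [term, sq]

/-- The sets of types that are used in feasible solutions. -/
def FeasibleTypes (rk : ℕ → Prop) (U : Fin s × Ty t → Prop) : Prop :=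
  ∃ (n : Fin s → ℕ) (z : ∀ j, Fin (n j) → Ty t),
    (∀ e, U e ↔ ∃ k, z e.1 k = e.2) ∧ Feasible rk z

/-- By monotonicity, feasibility is a property of the set of occurring types, independent of the
format. It thus becomes a finite condition that no longer refers to the instance. -/
theorem feasibleTypes_iff {rk : ℕ → Prop} (hrk : RankCondition t rk) {n : Fin s → ℕ}
    (z : ∀ j, Fin (n j) → Ty t) {U : Fin s × Ty t → Prop} (hU : ∀ e, U e ↔ ∃ k, z e.1 k = e.2) :
    FeasibleTypes rk U ↔ Feasible rk z := by
  refine ⟨?_, fun h => ⟨n, z, hU, h⟩⟩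
  rintro ⟨n', z', hU', h⟩
  exact h.mono hrk fun j k => (hU (j, z' j k)).1 ((hU' (j, z' j k)).2 ⟨k, rfl⟩)

/-- The condition for an update of the best solution. -/
def Improves (rk : ℕ → Prop) (S : Arrays (Cells s t q)) (ρ : ℕ → ℕ) : Prop :=
  FeasibleTypes rk (fun e => S (flag e) (ρ s) = 1) ∧
    (S found (ρ s) = 1 → S acc (ρ s) < S best (ρ s))

-- Feasibility is never computed: it is a fixed Boolean function of the finitely many type flags,
-- hard-wired into the expression.
open Classical in
theorem decides_improves (rk : ℕ → Prop) : Decides (Improves (s := s) (t := t) (q := q) rk) := by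
  have h := Expressible.table (B := (Fin s × Ty t) ⊕ Bool)
    (fun b => if FeasibleTypes rk (fun e => b (.inl e)) ∧ (b (.inr true) → b (.inr false))
      then 1 else 0)
    (P := Sum.elim (fun e (S : Arrays (Cells s t q)) ρ => S (flag e) (ρ s) = 1)
      fun b S ρ => if b then S found (ρ s) = 1 else S acc (ρ s) < S best (ρ s)) (by
      rintro (e | b | b)
      · exact (Expressible.var _ _).eq (.const 1)
      · exact (Expressible.var _ _).lt (.var _ _)
      · exact (Expressible.var _ _).eq (.const 1))
  unfold Decides
  convert h using 4
  simp [Improves]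

end BTF

/-! ### Correctness of the exhaustive search. -/

namespace BTF

open StronglyPoly

variable {s t q : ℕ}

/-! ### Evaluation of one candidate -/

theorem Inst.input_arr (I : Inst s q) (p : Fin q) (j : Fin s) (k : ℕ) :
    I.input.arr (p * s + j) k = I.row j k p := by
  have hs : 0 < s := j.pos
  have h1 : ((p : ℕ) * s + j) / s = p := by
    rw [mul_comm, Nat.mul_add_div hs, Nat.div_eq_of_lt j.2, add_zero]
  have h2 : ((p : ℕ) * s + j) % s = j := by
    rw [mul_comm, Nat.mul_add_mod, Nat.mod_eq_of_lt j.2]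
  have hc : ((p : ℕ) * s + j) / s < q ∧ ((p : ℕ) * s + j) % s < s := by
    rw [h1, h2]; exact ⟨p.2, j.2⟩
  have e : ∀ (m m' : ℕ) (hm : m < q) (hm' : m' < s), m = p → m' = j →
      (if h : k < I.n ⟨m', hm'⟩ then I.a ⟨m, hm⟩ ⟨m', hm'⟩ ⟨k, h⟩ else 0) = I.row j k p := by
    rintro m m' hm hm' rfl rfl
    rfl
  simp only [Inst.input, dif_pos hc]
  exact e _ _ hc.1 hc.2 h1 h2

/-- The arrays contain the input and the list of positions, and their cells have height at
most `M`. -/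
structure Loaded (I : Inst s q) (M : ℕ) (S : Arrays (Cells s t q)) : Prop where
  inp : ∀ p j k, S (inp p j) k = I.input.arr (p * s + j) k
  pos : ∀ k < I.dim + 3, S pos k = k
  bdd : Bounded M S

theorem Loaded.of_eq {I : Inst s q} {M : ℕ} {S S' : Arrays (Cells s t q)} (h : Loaded I M S)
    (h1 : ∀ p j, S' (BTF.inp p j) = S (BTF.inp p j)) (h2 : S' BTF.pos = S BTF.pos)
    (h3 : Bounded M S') : Loaded I M S' :=
  ⟨fun p j k => by rw [h1, h.inp], fun k hk => by rw [h2, h.pos k hk], h3⟩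

/-- The type of row `k` of factor `j` in the candidate described by `ρ`. -/
noncomputable def candTy (I : Inst s q) (ρ : ℕ → ℕ) (j : Fin s) (k : ℕ) : Ty t :=
  rowTy (I.row j) (fun k => (k : ℚ)) (fun e => ρ (gReg (j, e))) k

/-- The candidate described by `ρ`. -/
noncomputable def candAt (t : ℕ) (I : Inst s q) (ρ : ℕ → ℕ) : ∀ j, Fin (I.n j) → Ty t :=
  cand I fun j e => ρ (gReg (j, e))

/-- The value of the objective function at the candidate described by `ρ`. -/
noncomputable def obj (t : ℕ) (I : Inst s q) (ρ : ℕ → ℕ) : ℚ :=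
  sqDist I.tensor (approx (candAt t I ρ))

/-- The contribution to the objective function of the positions contained in `ρ'`. -/
noncomputable def termVal (t : ℕ) (I : Inst s q) (ρ ρ' : ℕ → ℕ) : ℚ :=
  (∑ p : Fin q, ∏ j, I.row j (ρ' (kReg j)) p -
    ∑ i : Fin t, ∏ j, bit (candTy I ρ j (ρ' (kReg j)) i)) ^ 2

section

variable {I : Inst s q} {ρ ρ' : ℕ → ℕ} {M : ℕ} {S : Arrays (Cells s t q)}

theorem IsGuessEnv.pos_lt (h : IsGuessEnv t I ρ) (h' : ρ' ∈ enum (kLoops s) ρ) (j : Fin s) :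
    ρ' (kReg j) < I.n j := ((h.mem_enum_k h.counter).1 h').1 j

theorem IsGuessEnv.greg_eq (h : IsGuessEnv t I ρ) (h' : ρ' ∈ enum (kLoops s) ρ)
    (e : Fin s × Guess t q) : ρ' (gReg e) = ρ (gReg e) :=
  ((h.mem_enum_k h.counter).1 h').2 _ fun j => kReg_ne_gReg j e

theorem IsGuessEnv.zero_eq (h : IsGuessEnv t I ρ) (h' : ρ' ∈ enum (kLoops s) ρ) : ρ' s = 0 := by
  rw [((h.mem_enum_k h.counter).1 h').2 s fun j => by simp only [kReg]; omega, h.zero]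

theorem Loaded.tyAt_eq (hS : Loaded I M S) (h : IsGuessEnv t I ρ)
    (h' : ρ' ∈ enum (kLoops s) ρ) (j : Fin s) :
    tyAt S ρ' j (ρ' (kReg j)) = candTy I ρ j (ρ' (kReg j)) := by
  have hw : (fun k (p : Fin q) => S (BTF.inp (p.castAdd t) j) k) = I.row j := by
    funext k p
    rw [hS.inp, ← I.input_arr]
    rfl
  rw [tyAt, candTy, hw]
  simp only [h.greg_eq h']
  refine rowTy_congr _ (hS.pos _ ?_) fun e => hS.pos _ (h.guess_lt (j, e))
  have := h.pos_lt h' j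
  have := I.n_le_dim j
  omega

theorem Loaded.term_eq (hS : Loaded I M S) (h : IsGuessEnv t I ρ)
    (h' : ρ' ∈ enum (kLoops s) ρ) : term S ρ' = termVal t I ρ ρ' := by
  simp only [term, termVal, hS.tyAt_eq h h', hS.inp, ← I.input_arr]
  rfl

theorem IsGuessEnv.sum_termVal (h : IsGuessEnv t I ρ) :
    ((enum (kLoops s) ρ).map (termVal t I ρ)).sum = obj t I ρ := by
  rw [h.sum_enum_k h.counter, obj, sqDist]
  refine Finset.sum_congr rfl fun κ _ => ?_
  simp only [termVal, setK_kReg, Inst.tensor, approx, Finset.sum_apply, outer, vec, candAt, cand,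
    candTy, Inst.row, Fin.is_lt, dite_true, Fin.eta]

/-- The loops run over positions of the whole tensor. Since all n j are positive, each row of each
factor is part of some position, so the flags see every occurring type. -/
theorem IsGuessEnv.exists_pos_iff (h : IsGuessEnv t I ρ) (e : Fin s × Ty t) :
    (∃ ρ' ∈ enum (kLoops s) ρ, candTy I ρ e.1 (ρ' (kReg e.1)) = e.2) ↔
      ∃ k, candAt t I ρ e.1 k = e.2 := by
  constructor
  · rintro ⟨ρ', h', he⟩
    exact ⟨⟨_, h.pos_lt h' e.1⟩, he⟩
  · rintro ⟨k, hk⟩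
    classical
    refine ⟨_, h.setK_mem h.counter (Function.update (fun j => ⟨0, I.n_pos j⟩) e.1 k), ?_⟩
    rw [setK_kReg, Function.update_self]
    exact hk

end

/-- All partial sums in the evaluation of the objective function have height at most `M`. -/
def SumBound (t : ℕ) (I : Inst s q) (M : ℕ) : Prop :=
  ∀ ρ m, IsGuessEnv t I ρ → m <+: enum (kLoops s) ρ → ht (m.map (termVal t I ρ)).sum ≤ M

open Classical in
/-- The state after the evaluation of the candidate described by `ρ` at the positions in `m`. -/
structure Evaluated (I : Inst s q) (M : ℕ) (ρ : ℕ → ℕ) (S₀ : Arrays (Cells s t q))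
    (m : List (ℕ → ℕ)) (S : Arrays (Cells s t q)) : Prop where
  loaded : Loaded I M S
  best : S best = S₀ best
  found : S found = S₀ found
  out : ∀ e, S (outv e) = S₀ (outv e)
  acc : S acc 0 = (m.map (termVal t I ρ)).sum
  flag : ∀ e, S (flag e) 0 = if ∃ ρ' ∈ m, candTy I ρ e.1 (ρ' (kReg e.1)) = e.2 then 1 else 0

theorem exists_reset (s t q : ℕ) : ∃ c C, ∀ (I : Inst s q) (W L M : ℕ) (ρ : ℕ → ℕ)
    (S₀ : Arrays (Cells s t q)), IsGuessEnv t I ρ → Loaded I M S₀ → 1 ≤ M → C * (M + 1) ≤ L →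
    Triple (code s t q) W L C ρ c (· = S₀) (Evaluated I M ρ S₀ []) := by
  obtain ⟨b₀, hb⟩ := exists_code_lt s t q
  obtain ⟨c, C, h⟩ := exists_assign (code_injective s t q) (z := s) hb (B := Option (Fin s × Ty t))
    (D := fun o => o.elim acc flag) (by rintro (_ | e) (_ | e') h <;> simp_all) (fun _ => s)
    (f := fun _ _ _ => 0) (fun _ => .const 0) (fun _ _ _ _ _ => rfl)
  refine ⟨c, C, fun I W L M ρ S₀ hρ hS hM hL => h W L M ρ _ _ hρ.zero hL ?_⟩
  rintro _ rfl
  refine ⟨hS.bdd, fun _ => by simpa using hM, fun S' hS' hA => ?_⟩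
  have hmiss := hA.miss_array
  have hit := fun b => hA.hit b (by simp)
  rw [Option.forall] at hit
  simp only [hρ.zero] at hit
  refine ⟨hS.of_eq (fun p j => hmiss _ ?_) (hmiss _ ?_) hS', hmiss _ ?_, hmiss _ ?_,
    fun e => hmiss _ ?_, ?_, fun e => ?_⟩
  on_goal 6 => simpa using hit.1
  on_goal 6 => simpa using hit.2 e
  all_goals rintro (_ | e) <;> simp

-- The height of the new accumulator is taken from `SumBound`, which holds for all prefixes at once.
-- Estimating it from the old accumulator would compound over the passes.
set_option maxHeartbeats 1000000 in
open Classical in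
theorem exists_step (s t q : ℕ) : ∃ c C, ∀ (I : Inst s q) (W L M : ℕ) (ρ ρ' : ℕ → ℕ)
    (S₀ : Arrays (Cells s t q)) (m : List (ℕ → ℕ)), IsGuessEnv t I ρ → SumBound t I M → 1 ≤ M →
    C * (M + 1) ≤ L → m ++ [ρ'] <+: enum (kLoops s) ρ →
    Triple (code s t q) W L C ρ' c (Evaluated I M ρ S₀ m) (Evaluated I M ρ S₀ (m ++ [ρ'])) := by
  obtain ⟨b₀, hb⟩ := exists_code_lt s t q
  obtain ⟨c, C, h⟩ := exists_assign (code_injective s t q) (z := s) hb (B := Option (Fin s × Ty t))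
    (D := fun o => o.elim acc flag) (by rintro (_ | e) (_ | e') h <;> simp_all) (fun _ => s)
    (f := fun o S ρ => o.elim (S acc (ρ s) + term S ρ) fun e =>
      if tyAt S ρ e.1 (ρ (kReg e.1)) = e.2 then 1 else S (flag e) (ρ s)) (by
      rintro (_ | e)
      · exact (Expressible.var _ _).add expressible_term
      · have : Decides fun (S : Arrays (Cells s t q)) ρ => tyAt S ρ e.1 (ρ (kReg e.1)) = e.2 := by
          unfold Decides
          convert expressible_tyAt (fun y => if y = e.2 then 1 else 0) e.1 (kReg e.1) using 3
          beta_reduce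
          congr
        exact this.ite (.const 1) (.var (flag e) s)) (by
      intro o S S' ρ hSS
      have hi : ∀ p j, S (inp p j) = S' (inp p j) := fun p j =>
        hSS _ (.inr (by rintro (_ | e) <;> simp))
      have hp : S pos = S' pos := hSS _ (.inr (by rintro (_ | e) <;> simp))
      have hself := hSS _ (.inl rfl)
      rcases o with _ | e <;> simp only [Option.elim] at hself ⊢ <;>
        simp only [hself, term, tyAt_congr hi hp, hi])
  refine ⟨c, C, fun I W L M ρ ρ' S₀ m hρ hM hM1 hL hm => ?_⟩
  have hmem : ρ' ∈ enum (kLoops s) ρ := hm.subset (by simp)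
  have hz := hρ.zero_eq hmem
  refine h W L M ρ' _ _ hz hL fun S hS => ?_
  have hacc : S acc (ρ' s) + term S ρ' = ((m ++ [ρ']).map (termVal t I ρ)).sum := by
    rw [hz, hS.acc, hS.loaded.term_eq hρ hmem]; simp
  refine ⟨hS.loaded.bdd, ?_, fun S' hS' hA => ?_⟩
  · rintro (_ | e)
    · simp only [Option.elim, hacc]
      exact hM ρ _ hρ hm
    · simp only [Option.elim]
      split_ifs
      · simpa using hM1
      · exact hS.loaded.bdd _ _
  have hmiss := hA.miss_array
  have hit := fun b => hA.hit b (by simp)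
  rw [Option.forall] at hit
  simp only [Option.elim, hacc, hS.loaded.tyAt_eq hρ hmem] at hit
  simp only [hz] at hit
  refine ⟨hS.loaded.of_eq (fun p j => hmiss _ ?_) (hmiss _ ?_) hS', (hmiss _ ?_).trans hS.best,
    (hmiss _ ?_).trans hS.found, fun e => (hmiss _ ?_).trans (hS.out e), ?_, fun e => ?_⟩
  on_goal 6 => exact hit.1
  on_goal 6 =>
    refine (hit.2 e).trans ?_
    have hor : (∃ ρ'' ∈ m ++ [ρ'], candTy I ρ e.1 (ρ'' (kReg e.1)) = e.2) ↔
        (∃ ρ'' ∈ m, candTy I ρ e.1 (ρ'' (kReg e.1)) = e.2) ∨ candTy I ρ e.1 (ρ' (kReg e.1)) = e.2 := by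
      simp only [List.mem_append, List.mem_singleton, or_and_right, exists_or, exists_eq_left]
    rw [hS.flag e]
    by_cases h1 : candTy I ρ e.1 (ρ' (kReg e.1)) = e.2
    · rw [if_pos h1, if_pos (hor.2 (.inr h1))]
    · rw [if_neg h1]
      by_cases h2 : ∃ ρ'' ∈ m, candTy I ρ e.1 (ρ'' (kReg e.1)) = e.2
      · rw [if_pos h2, if_pos (hor.2 (.inl h2))]
      · rw [if_neg h2, if_neg fun h => (hor.1 h).elim h2 h1]
  all_goals rintro (_ | e) <;> simp

theorem exists_eval (s t q : ℕ) : ∃ c C, ∀ (I : Inst s q) (W L M : ℕ) (ρ : ℕ → ℕ)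
    (S₀ : Arrays (Cells s t q)), IsGuessEnv t I ρ → Loaded I M S₀ → SumBound t I M →
    1 ≤ M → I.dim + 3 ≤ W → C * (M + 1) ≤ L →
    Triple (code s t q) W L (C + nestTime (I.dim + 3) C s) ρ c (· = S₀)
      (Evaluated I M ρ S₀ (enum (kLoops s) ρ)) := by
  obtain ⟨c₁, C₁, h₁⟩ := exists_reset s t q
  obtain ⟨c₂, C₂, h₂⟩ := exists_step s t q
  refine ⟨.seq c₁ (nest (s + 1) (kLoops s) c₂), C₁ + C₂, ?_⟩
  intro I W L M ρ S₀ hρ hS hM hM1 hW hL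
  have hL1 : C₁ * (M + 1) ≤ L := by nlinarith
  have hL2 : C₂ * (M + 1) ≤ L := by nlinarith
  have := triple_nest hW (kLoops s) ρ (hρ.loopRegs_k hρ.counter) (Evaluated I M ρ S₀)
    (T := C₁ + C₂) fun m ρ' hm => (h₂ I W L M ρ ρ' S₀ m hρ hM hM1 hL2 hm).mono (Nat.le_add_left _ _)
      (fun _ h => h) fun _ h => h
  have hlen : (kLoops s).length = s := by simp [kLoops]
  rw [hlen] at this
  exact (h₁ I W L M ρ S₀ hρ hS hM1 hL1).seq this |>.mono (by omega) (fun _ h => h) fun _ h => h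

/-! ### Update of the best solution -/

/-- The candidate described by `ρ` is feasible and better than the best one found so far. -/
def Better (rk : ℕ → Prop) (I : Inst s q) (ρ : ℕ → ℕ) (S₀ : Arrays (Cells s t q)) : Prop :=
  Feasible rk (candAt t I ρ) ∧ (S₀ found 0 = 1 → obj t I ρ < S₀ best 0)

open Classical in
/-- The new contents of the arrays for the best solution. -/
noncomputable def newOut (rk : ℕ → Prop) (I : Inst s q) (ρ : ℕ → ℕ) (S₀ : Arrays (Cells s t q))
    (e : Fin t × Fin s) (k : ℕ) : ℚ :=
  if Better rk I ρ S₀ then bit (candTy I ρ e.2 k e.1) else S₀ (outv e) k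

open Classical in
/-- The state after the comparison of the candidate described by `ρ` with the best one so far,
and after the update of the arrays for the best solution at the positions in `m`. -/
structure Updated (rk : ℕ → Prop) (I : Inst s q) (M : ℕ) (ρ : ℕ → ℕ) (S₀ : Arrays (Cells s t q))
    (m : List (ℕ → ℕ)) (S : Arrays (Cells s t q)) : Prop where
  loaded : Loaded I M S
  upd : S upd 0 = if Better rk I ρ S₀ then 1 else 0
  best : S best 0 = if Better rk I ρ S₀ then obj t I ρ else S₀ best 0
  found : S found 0 = if Better rk I ρ S₀ then 1 else S₀ found 0
  out : ∀ e k, S (outv e) k = newOut rk I ρ S₀ e k ∨ S (outv e) k = S₀ (outv e) k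
  done : ∀ e, ∀ ρ' ∈ m, S (outv e) (ρ' (kReg e.2)) = newOut rk I ρ S₀ e (ρ' (kReg e.2))

open Classical in
theorem exists_compare {rk : ℕ → Prop} (hrk : RankCondition t rk) (s q : ℕ) :
    ∃ c C, ∀ (I : Inst s q) (W L M : ℕ) (ρ : ℕ → ℕ)
    (S₀ : Arrays (Cells s t q)), IsGuessEnv t I ρ → 1 ≤ M → C * (M + 1) ≤ L →
    Triple (code s t q) W L C ρ c (Evaluated I M ρ S₀ (enum (kLoops s) ρ))
      (Updated rk I M ρ S₀ []) := by
  obtain ⟨b₀, hb⟩ := exists_code_lt s t q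
  obtain ⟨c₁, C₁, h₁⟩ := exists_assign (code_injective s t q) (z := s) hb (B := Unit)
    (D := fun _ => upd) (fun _ _ _ => rfl) (fun _ => s)
    (f := fun _ S ρ => if Improves rk S ρ then 1 else 0) (fun _ => decides_improves rk) (by
      rintro _ S S' ρ hSS
      have h1 : S acc = S' acc := hSS _ (.inr fun _ => by simp)
      have h2 : S best = S' best := hSS _ (.inr fun _ => by simp)
      have h3 : S found = S' found := hSS _ (.inr fun _ => by simp)
      have h4 : ∀ e, S (flag e) = S' (flag e) := fun e => hSS _ (.inr fun _ => by simp)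
      have h5 : Improves rk S ρ = Improves rk S' ρ := by simp only [Improves, h1, h2, h3, h4]
      rw [h5])
  obtain ⟨c₂, C₂, h₂⟩ := exists_assign (code_injective s t q) (z := s) hb (B := Bool)
    (D := fun b => if b then found else best) (by rintro (_ | _) (_ | _) h <;> simp_all) (fun _ => s)
    (f := fun b S ρ => if S upd (ρ s) = 1 then (if b then 1 else S acc (ρ s)) else
      if b then S found (ρ s) else S best (ρ s)) (by
      rintro (_ | _)
      · simpa using ((Expressible.var upd s).eq (.const 1)).ite (.var acc s) (.var best s)
      · simpa using ((Expressible.var upd s).eq (.const 1)).ite (.const 1) (.var found s)) (by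
      rintro b S S' ρ hSS
      have h1 : S acc = S' acc := hSS _ (.inr (by rintro (_ | _) <;> simp))
      have h2 : S upd = S' upd := hSS _ (.inr (by rintro (_ | _) <;> simp))
      have hself := hSS _ (.inl rfl)
      rcases b with _ | _
      · have h3 : S best = S' best := hself
        simp only [h1, h2, h3, Bool.false_eq_true, if_false]
      · have h3 : S found = S' found := hself
        simp only [h2, h3, if_true])
  refine ⟨.seq c₁ c₂, C₁ + C₂, fun I W L M ρ S₀ hρ hM hL => ?_⟩
  have hL1 : C₁ * (M + 1) ≤ L := by nlinarith
  have hL2 : C₂ * (M + 1) ≤ L := by nlinarith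
  -- The decision is stored in `upd` beforehand, since `best` and `found`, on which it depends, are
  -- then overwritten while the later saving loop still needs it.
  refine .seq (Q := fun S => Loaded I M S ∧ S acc 0 = obj t I ρ ∧ S best = S₀ best ∧
    S found = S₀ found ∧ (∀ e, S (outv e) = S₀ (outv e)) ∧
    S upd 0 = if Better rk I ρ S₀ then 1 else 0) (h₁ W L M ρ _ _ hρ.zero hL1 fun S hS => ?_)
    (h₂ W L M ρ _ _ hρ.zero hL2 ?_)
  · have himp : Improves rk S ρ ↔ Better rk I ρ S₀ := by
      rw [Improves, Better, hρ.zero, hS.acc, hρ.sum_termVal, hS.best, hS.found,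
        feasibleTypes_iff hrk (candAt t I ρ)]
      intro e
      rw [hS.flag, ← hρ.exists_pos_iff]
      split_ifs with h <;> simp [h]
    refine ⟨hS.loaded.bdd, fun _ => ?_, fun S' hS' hA => ?_⟩
    · split_ifs <;> simpa using hM
    have hmiss := hA.miss_array
    have hit := hA.hit () (by simp)
    simp only [himp, hρ.zero] at hit
    refine ⟨hS.loaded.of_eq (fun p j => hmiss _ ?_) (hmiss _ ?_) hS', ?_, (hmiss _ ?_).trans hS.best,
      (hmiss _ ?_).trans hS.found, fun e => (hmiss _ ?_).trans (hS.out e), hit⟩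
    on_goal 3 => rw [hmiss acc (by simp), hS.acc, hρ.sum_termVal]
    all_goals simp
  · rintro S ⟨hS, hacc, hbest, hfound, hout, hupd⟩
    have hu : S upd 0 = 1 ↔ Better rk I ρ S₀ := by
      rw [hupd]; split_ifs with h <;> simp [h]
    refine ⟨hS.bdd, fun b => ?_, fun S' hS' hA => ?_⟩
    · split_ifs
      · simpa using hM
      all_goals exact hS.bdd _ _
    have hmiss := hA.miss_array
    have hit := fun b => hA.hit b (by simp)
    simp only [hρ.zero, hu, hacc, hbest, hfound] at hit
    refine ⟨hS.of_eq (fun p j => hmiss _ ?_) (hmiss _ ?_) hS', ?_, ?_, ?_, fun e k => .inr ?_,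
      by simp⟩
    on_goal 3 => rw [hmiss upd (by rintro (_ | _) <;> simp), hupd]
    on_goal 3 => simpa using hit false
    on_goal 3 => simpa using hit true
    on_goal 3 => rw [hmiss (outv e) (by rintro (_ | _) <;> simp), hout]
    all_goals rintro (_ | _) <;> simp

-- A row is visited once for each position containing it. The value written depends only on the row
-- and the candidate, so repeated writing is harmless.
open Classical in
theorem exists_save (rk : ℕ → Prop) (s t q : ℕ) : ∃ c C, ∀ (I : Inst s q) (W L M : ℕ)
    (ρ ρ' : ℕ → ℕ) (S₀ : Arrays (Cells s t q)) (m : List (ℕ → ℕ)), IsGuessEnv t I ρ → 1 ≤ M →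
    C * (M + 1) ≤ L → m ++ [ρ'] <+: enum (kLoops s) ρ →
    Triple (code s t q) W L C ρ' c (Updated rk I M ρ S₀ m) (Updated rk I M ρ S₀ (m ++ [ρ'])) := by
  obtain ⟨b₀, hb⟩ := exists_code_lt s t q
  obtain ⟨c, C, h⟩ := exists_assign (code_injective s t q) (z := s) hb (B := Fin t × Fin s)
    (D := outv) (fun e e' h => by simpa using h) (fun e => kReg e.2)
    (f := fun e S ρ => if S upd (ρ s) = 1 then
      bit (tyAt S ρ e.2 (ρ (kReg e.2)) e.1) else S (outv e) (ρ (kReg e.2)))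
    (fun e => ((Expressible.var upd s).eq (.const 1)).ite
      (expressible_tyAt (fun y => bit (y e.1)) _ _) (.var _ _)) (by
      intro e S S' ρ hSS
      have hi : ∀ p j, S (inp p j) = S' (inp p j) := fun p j => hSS _ (.inr (by simp))
      have hp : S pos = S' pos := hSS _ (.inr (by simp))
      have hu : S upd = S' upd := hSS _ (.inr (by simp))
      have hself := hSS _ (.inl rfl)
      simp only [hself, tyAt_congr hi hp, hu])
  refine ⟨c, C, fun I W L M ρ ρ' S₀ m hρ hM hL hm => ?_⟩
  have hmem : ρ' ∈ enum (kLoops s) ρ := hm.subset (by simp)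
  have hz := hρ.zero_eq hmem
  refine h W L M ρ' _ _ hz hL fun S hS => ?_
  have hu : S upd (ρ' s) = 1 ↔ Better rk I ρ S₀ := by
    rw [hz, hS.upd]; split_ifs with h <;> simp [h]
  have hval : ∀ e : Fin t × Fin s, (if S upd (ρ' s) = 1 then
      bit (tyAt S ρ' e.2 (ρ' (kReg e.2)) e.1) else S (outv e) (ρ' (kReg e.2))) =
      newOut rk I ρ S₀ e (ρ' (kReg e.2)) := by
    intro e
    simp only [hu, hS.loaded.tyAt_eq hρ hmem]
    by_cases hB : Better rk I ρ S₀
    · simp only [newOut, if_pos hB]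
    · rcases hS.out e (ρ' (kReg e.2)) with h | h
      · rw [if_neg hB, h]
      · rw [if_neg hB, h, newOut, if_neg hB]
  refine ⟨hS.loaded.bdd, fun e => ?_, fun S' hS' hA => ?_⟩
  · split_ifs
    · rw [ht_bit]; exact hM
    · exact hS.loaded.bdd _ _
  have hmiss := hA.miss_array
  have hit : ∀ e, S' (outv e) (ρ' (kReg e.2)) = newOut rk I ρ S₀ e (ρ' (kReg e.2)) := fun e =>
    (hA.hit e (by simp)).trans (hval e)
  have hmiss' : ∀ e k, k ≠ ρ' (kReg e.2) → S' (outv e) k = S (outv e) k := fun e k hk =>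
    hA.miss _ _ fun e' _ he => by
      have : e' = e := by simpa using he
      rw [this]; exact hk.symm
  refine ⟨hS.loaded.of_eq (fun p j => hmiss _ ?_) (hmiss _ ?_) hS', ?_, ?_, ?_, fun e k => ?_,
    fun e ρ'' h'' => ?_⟩
  on_goal 3 => rw [hmiss upd (by simp), hS.upd]
  on_goal 3 => rw [hmiss best (by simp), hS.best]
  on_goal 3 => rw [hmiss found (by simp), hS.found]
  on_goal 3 =>
    by_cases hk : k = ρ' (kReg e.2)
    · rw [hk]; exact .inl (hit e)
    · rw [hmiss' e k hk]; exact hS.out e k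
  on_goal 3 =>
    by_cases hk : ρ'' (kReg e.2) = ρ' (kReg e.2)
    · rw [hk]; exact hit e
    · rw [hmiss' e _ hk]
      rcases List.mem_append.1 h'' with h'' | h''
      · exact hS.done e ρ'' h''
      · exact absurd (by rw [List.mem_singleton.1 h'']) hk
  all_goals simp

/-- The state after the candidates described by the elements of `m` have been tried. -/
structure Searched (rk : ℕ → Prop) (I : Inst s q) (M : ℕ) (m : List (ℕ → ℕ))
    (S : Arrays (Cells s t q)) : Prop where
  loaded : Loaded I M S
  search : (S found 0 ≠ 1 ∧ ∀ ρ ∈ m, ¬ Feasible rk (candAt t I ρ)) ∨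
    (S found 0 = 1 ∧ ∃ ρ ∈ m, Feasible rk (candAt t I ρ) ∧ S best 0 = obj t I ρ ∧
      (∀ e (k : Fin (I.n e.2)), S (outv e) k = vec (candAt t I ρ) e.1 e.2 k) ∧
      ∀ ρ' ∈ m, Feasible rk (candAt t I ρ') → obj t I ρ ≤ obj t I ρ')

/-- A rejected candidate is infeasible or not cheaper than the stored one. While nothing is stored,
any feasible candidate is accepted. -/
theorem Updated.searched {rk : ℕ → Prop} {I : Inst s q} {M : ℕ} {ρ : ℕ → ℕ} (hρ : IsGuessEnv t I ρ)
    {S₀ S : Arrays (Cells s t q)} (h : Updated rk I M ρ S₀ (enum (kLoops s) ρ) S)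
    {m : List (ℕ → ℕ)} (h₀ : Searched rk I M m S₀) : Searched rk I M (m ++ [ρ]) S := by
  classical
  refine ⟨h.loaded, ?_⟩
  have hout : ∀ e (k : Fin (I.n e.2)), S (outv e) k = newOut rk I ρ S₀ e k := by
    intro e k
    have := h.done e _ (hρ.setK_mem hρ.counter (Function.update (fun j => ⟨0, I.n_pos j⟩) e.2 k))
    rwa [setK_kReg, Function.update_self] at this
  simp only [List.mem_append, List.mem_singleton]
  by_cases hB : Better rk I ρ S₀
  · refine .inr ⟨by rw [h.found, if_pos hB], ρ, .inr rfl, hB.1, by rw [h.best, if_pos hB],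
      fun e k => ?_, fun ρ' hρ' hf => ?_⟩
    · rw [hout, newOut, if_pos hB]
      rfl
    · rcases hρ' with hρ' | rfl
      · rcases h₀.search with h₁ | ⟨h₁, ρ₁, _, _, h₂, _, h₃⟩
        · exact absurd hf (h₁.2 _ hρ')
        · exact (hB.2 h₁).le.trans (h₂.trans_le (h₃ _ hρ' hf))
      · exact le_rfl
  · have hf : S BTF.found 0 = S₀ BTF.found 0 := by rw [h.found, if_neg hB]
    have hb : S BTF.best 0 = S₀ BTF.best 0 := by rw [h.best, if_neg hB]
    have ho : ∀ e (k : Fin (I.n e.2)), S (outv e) k = S₀ (outv e) k := fun e k => by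
      rw [hout, newOut, if_neg hB]
    rcases h₀.search with ⟨h₁, h₂⟩ | ⟨h₁, ρ₁, k₁, k₂, k₃, k₄, k₅⟩
    · refine .inl ⟨by rwa [hf], ?_⟩
      rintro ρ' (hρ' | rfl)
      · exact h₂ _ hρ'
      · exact fun hF => hB ⟨hF, fun hh => absurd hh h₁⟩
    · refine .inr ⟨by rwa [hf], ρ₁, .inl k₁, k₂, by rw [hb, k₃], fun e k => by rw [ho, k₄], ?_⟩
      rintro ρ' (hρ' | rfl) hF
      · exact k₅ _ hρ' hF
      · rw [← k₃]
        exact not_lt.1 fun hlt => hB ⟨hF, fun _ => hlt⟩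

theorem nestTime_mono {T T' : ℕ} (h : T ≤ T') (N m : ℕ) : nestTime N T m ≤ nestTime N T' m := by
  induction m with
  | zero => exact h
  | succ m ih => simp only [nestTime]; gcongr

/-- Time bound for the treatment of one candidate. -/
def candTime (s C N : ℕ) : ℕ := 2 * C + 2 * nestTime N C s

theorem exists_try {rk : ℕ → Prop} (hrk : RankCondition t rk) (s q : ℕ) :
    ∃ c C, ∀ (I : Inst s q) (W L M : ℕ) (ρ : ℕ → ℕ) (m : List (ℕ → ℕ)),
    IsGuessEnv t I ρ → SumBound t I M → 1 ≤ M → I.dim + 3 ≤ W → C * (M + 1) ≤ L →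
    Triple (code s t q) W L (candTime s C (I.dim + 3)) ρ c (Searched rk I M m)
      (Searched rk I M (m ++ [ρ])) := by
  obtain ⟨c₁, C₁, h₁⟩ := exists_eval s t q
  obtain ⟨c₂, C₂, h₂⟩ := exists_compare hrk s q
  obtain ⟨c₃, C₃, h₃⟩ := exists_save rk s t q
  refine ⟨.seq c₁ (.seq c₂ (nest (s + 1) (kLoops s) c₃)), C₁ + C₂ + C₃, ?_⟩
  intro I W L M ρ m hρ hM hM1 hW hL
  have hL1 : C₁ * (M + 1) ≤ L := by nlinarith
  have hL2 : C₂ * (M + 1) ≤ L := by nlinarith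
  have hL3 : C₃ * (M + 1) ≤ L := by nlinarith
  have hmono : ∀ C C' : ℕ, C ≤ C' → nestTime (I.dim + 3) C s ≤ nestTime (I.dim + 3) C' s := by
    intro C C' hC
    exact nestTime_mono hC _ _
  refine .of_forall fun S₀ hS₀ => ?_
  have := triple_nest hW (kLoops s) ρ (hρ.loopRegs_k hρ.counter) (Updated rk I M ρ S₀)
    fun m ρ' hm => h₃ I W L M ρ ρ' S₀ m hρ hM1 hL3 hm
  have hlen : (kLoops s).length = s := by simp [kLoops]
  rw [hlen] at this
  refine ((h₁ I W L M ρ S₀ hρ hS₀.loaded hM hM1 hW hL1).seq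
    ((h₂ I W L M ρ S₀ hρ hM1 hL2).seq this)).mono ?_ (fun _ h => h) fun S hS => hS.searched hρ hS₀
  have e1 := hmono C₁ (C₁ + C₂ + C₃) (by omega)
  have e3 := hmono C₃ (C₁ + C₂ + C₃) (by omega)
  unfold candTime
  omega

end BTF

/-! ### Set-up, output and polynomial bounds. -/

namespace BTF

open StronglyPoly

variable {s t q : ℕ}

/-! ### Bounds on the input and on the objective function -/

theorem Inst.dim_le_size (I : Inst s q) : I.dim ≤ I.size := Nat.le_add_right _ _

theorem Inst.ht_input_le (I : Inst s q) (A k : ℕ) : ht (I.input.arr A k) ≤ I.size + 1 := by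
  simp only [Inst.input]
  split_ifs with h hk
  · refine (ht_le_ratSize _).trans (le_trans ?_ (Nat.le_succ _))
    refine le_trans ?_ (Nat.le_add_left _ _)
    let p : Fin q := ⟨A / s, h.1⟩
    let j : Fin s := ⟨A % s, h.2⟩
    calc ratSize (I.a p j ⟨k, hk⟩) ≤ ∑ k, ratSize (I.a p j k) :=
          Finset.single_le_sum (f := fun k => ratSize (I.a p j k)) (fun _ _ => Nat.zero_le _)
            (Finset.mem_univ _)
      _ ≤ ∑ j, ∑ k, ratSize (I.a p j k) :=
          Finset.single_le_sum (f := fun j => ∑ k, ratSize (I.a p j k)) (fun _ _ => Nat.zero_le _)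
            (Finset.mem_univ _)
      _ ≤ ∑ p, ∑ j, ∑ k, ratSize (I.a p j k) :=
          Finset.single_le_sum (f := fun p => ∑ j, ∑ k, ratSize (I.a p j k))
            (fun _ _ => Nat.zero_le _) (Finset.mem_univ _)
  · simp
  · simp

theorem Inst.input_arr_eq_zero (I : Inst s q) (hs : 0 < s) {A : ℕ} (hA : q * s ≤ A) (k : ℕ) :
    I.input.arr A k = 0 := by
  have : ¬ A / s < q := by
    rw [Nat.div_lt_iff_lt_mul hs]; omega
  simp [Inst.input, this]

/-- Arrays that contain only the input and the list of positions. -/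
def initial (t : ℕ) (I : Inst s q) : Arrays (Cells s t q) :=
  Sum.elim (fun e k => I.input.arr (e.1 * s + e.2) k)
    (Sum.elim (fun i k => if i = 0 ∧ k < I.dim + 3 then k else 0) fun _ _ => 0)

theorem loaded_initial (t : ℕ) (I : Inst s q) : Loaded I (I.size + 5) (initial t I) := by
  refine ⟨fun _ _ _ => rfl, fun k hk => by simp [initial, hk], ?_⟩
  have := I.dim_le_size
  rintro (e | i | v) k
  · exact (I.ht_input_le _ _).trans (by omega)
  · simp only [initial, Sum.elim_inr, Sum.elim_inl]
    split_ifs with h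
    · exact (ht_natCast_le k).trans (by omega)
    · simp
  · simp [initial]

/-- The summands agree with those evaluated in the state `initial`, whose heights are at most size +
5. This bounds them without reference to M and avoids a circular choice of M. There are at most (dim
+ 3)^s summands. -/
theorem exists_sumBound (s t q : ℕ) : ∃ C, ∀ (I : Inst s q) (M : ℕ),
    (I.size + 3) ^ s * (C * (I.size + 6) + 1) + 1 ≤ M → SumBound t I M := by
  obtain ⟨C, hC⟩ := (expressible_term (s := s) (t := t) (q := q)).exists_ht_le
  refine ⟨C, fun I M hM ρ m hρ hm => le_trans ?_ hM⟩
  have hlr := hρ.loopRegs_k hρ.counter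
  refine (ht_listSum_le (M := C * (I.size + 6)) _ ?_).trans ?_
  · simp only [List.mem_map]
    rintro _ ⟨ρ', h', rfl⟩
    have hL := loaded_initial t I
    rw [← hL.term_eq hρ (hm.subset h')]
    exact hC _ _ _ hL.bdd
  · refine Nat.add_le_add_right (Nat.mul_le_mul_right _ ?_) 1
    rw [List.length_map]
    refine hm.length_le.trans ((length_enum_le hlr).trans ?_)
    rw [show (kLoops s).length = s by simp [kLoops]]
    exact Nat.pow_le_pow_left (Nat.add_le_add_right I.dim_le_size 3) s

/-! ### The list of positions -/

/-- The state after `m` passes of the loop that builds the list of positions. -/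
structure Counted (I : Inst s q) (M : ℕ) (m : List (ℕ → ℕ)) (S : Arrays (Cells s t q)) : Prop where
  inp : ∀ p j k, S (inp p j) k = I.input.arr (p * s + j) k
  bdd : Bounded M S
  found : S found 0 = 0
  ctr : S ctr 0 = m.length
  pos : ∀ ρ ∈ m, S pos (ρ (s + 3)) = ρ (s + 3)

theorem eq_of_prefix_enum_singleton {r b : ℕ} {ρ ρ' : ℕ → ℕ} {m : List (ℕ → ℕ)}
    (h : m ++ [ρ'] <+: enum [(r, b)] ρ) : m.length < ρ b ∧ ρ' = Function.update ρ r m.length := by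
  have he : enum [(r, b)] ρ = (List.range (ρ b)).map (Function.update ρ r) := by
    simp only [enum, List.map_eq_flatMap]
  rw [he] at h
  have hlen := h.length_le
  simp only [List.length_append, List.length_singleton, List.length_map, List.length_range] at hlen
  refine ⟨by omega, ?_⟩
  have := h.getElem (i := m.length) (by simp)
  simpa using this

/-- Indices cannot be moved into the rational bank, so a rational counter is incremented in step
with the loop register. It ends at dim + 3, whose height is at most dim + 4. -/
theorem exists_count (s t q : ℕ) : ∃ c C, ∀ (I : Inst s q) (W L M : ℕ), I.size + 5 ≤ M →
    I.dim + 3 ≤ W → C * (M + 1) ≤ L →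
    Triple (code s t q) W L (nestTime (I.dim + 3) C 1) I.regs c (Counted I M [])
      (Counted I M (enum [(s + 3, s + 2)] I.regs)) := by
  obtain ⟨b₀, hb⟩ := exists_code_lt s t q
  obtain ⟨c₁, C₁, h₁⟩ := exists_assign (code_injective s t q) (z := s) hb (B := Unit)
    (D := fun _ => pos) (fun _ _ _ => rfl) (fun _ => s + 3)
    (f := fun _ S ρ => S ctr (ρ s)) (fun _ => .var _ _) (by
      rintro _ S S' ρ hSS
      rw [show S ctr = S' ctr from hSS _ (.inr fun _ => by simp)])
  obtain ⟨c₂, C₂, h₂⟩ := exists_assign (code_injective s t q) (z := s) hb (B := Unit)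
    (D := fun _ => ctr) (fun _ _ _ => rfl) (fun _ => s)
    (f := fun _ S ρ => S ctr (ρ s) + 1) (fun _ => (Expressible.var _ _).add (.const 1)) (by
      rintro _ S S' ρ hSS
      rw [show S ctr = S' ctr from hSS _ (.inl rfl)])
  refine ⟨nest (s + 1) [(s + 3, s + 2)] (.seq c₁ c₂), C₁ + C₂, fun I W L M hM hW hL => ?_⟩
  have hL1 : C₁ * (M + 1) ≤ L := by nlinarith
  have hL2 : C₂ * (M + 1) ≤ L := by nlinarith
  have hE := I.isEnv_regs
  have hlr : LoopRegs (s + 1) (I.dim + 3) [(s + 3, s + 2)] I.regs := by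
    refine ⟨by simp, by simp, by simp, ?_, by simp [hE.bound], hE.one⟩
    have h1 : ¬ s + 3 < s := by omega
    simp [Inst.regs]
  refine triple_nest hW [(s + 3, s + 2)] I.regs hlr (Counted I M) fun m ρ' hm => ?_
  obtain ⟨hlen, rfl⟩ := eq_of_prefix_enum_singleton hm
  rw [hE.bound] at hlen
  have hd := I.dim_le_size
  set ρ' := Function.update I.regs (s + 3) m.length with hρ'
  have hz : ρ' s = 0 := by simp [hρ', hE.zero]
  have hk : ρ' (s + 3) = m.length := by simp [hρ']
  refine .seq (Q := fun S => Counted I M m S ∧ S pos m.length = m.length)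
    (h₁ W L M ρ' _ _ hz hL1 fun S hS => ?_) (h₂ W L M ρ' _ _ hz hL2 ?_)
  · refine ⟨hS.bdd, fun _ => hS.bdd _ _, fun S' hS' hA => ?_⟩
    have hmiss := hA.miss_array
    have hit := hA.hit () (by simp)
    simp only [hz, hk, hS.ctr] at hit
    refine ⟨⟨fun p j k => ?_, hS', ?_, ?_, fun ρ hρ => ?_⟩, hit⟩
    · rw [hmiss _ (by simp), hS.inp]
    · rw [hmiss _ (by simp), hS.found]
    · rw [hmiss _ (by simp), hS.ctr]
    · by_cases h : ρ (s + 3) = m.length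
      · rw [h, hit]
      · rw [hA.miss _ _ fun _ _ _ => by rw [hk]; exact Ne.symm h, hS.pos ρ hρ]
  · rintro S ⟨hS, hp⟩
    have hval : S ctr (ρ' s) + 1 = ((m ++ [ρ']).length : ℕ) := by rw [hz, hS.ctr]; simp
    refine ⟨hS.bdd, fun _ => ?_, fun S' hS' hA => ?_⟩
    · rw [hval]
      refine (ht_natCast_le _).trans ?_
      rw [List.length_append, List.length_singleton]
      omega
    have hmiss := hA.miss_array
    have hit := hA.hit () (by simp)
    simp only [hval] at hit
    rw [hz] at hit
    refine ⟨fun p j k => ?_, hS', ?_, hit, fun ρ hρ => ?_⟩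
    · rw [hmiss _ (by simp), hS.inp]
    · rw [hmiss _ (by simp), hS.found]
    · rw [hmiss _ (by simp)]
      rcases List.mem_append.1 hρ with hρ | hρ
      · exact hS.pos ρ hρ
      · rw [List.mem_singleton.1 hρ, hk, hp]

theorem Counted.searched {rk : ℕ → Prop} {I : Inst s q} {M : ℕ} {S : Arrays (Cells s t q)}
    (h : Counted I M (enum [(s + 3, s + 2)] I.regs) S) : Searched rk I M [] S := by
  refine ⟨⟨h.inp, fun k hk => ?_, h.bdd⟩, .inl ⟨by rw [h.found]; norm_num, by simp⟩⟩
  have := h.pos (Function.update I.regs (s + 3) k) (by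
    simp only [enum, List.mem_flatMap, List.mem_range, List.mem_singleton]
    exact ⟨k, by rwa [I.isEnv_regs.bound], rfl⟩)
  simpa using this

/-! ### Output of the solution -/

/-- The state after the output of the entries at the positions in `m`. -/
structure Printed (M : ℕ) (S₀ : Arrays (Cells s t q)) (m : List (ℕ → ℕ))
    (S : Arrays (Cells s t q)) : Prop where
  bdd : Bounded M S
  out : ∀ e, S (outv e) = S₀ (outv e)
  done : ∀ e : Fin t × Fin s, ∀ ρ ∈ m,
    S (inp (e.1.castLE (Nat.le_add_left t q)) e.2) (ρ (kReg e.2)) = S₀ (outv e) (ρ (kReg e.2))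

/-- Output and input share array numbers. The best solution is therefore buffered in `outv` and
copied only after the search, when the input is no longer needed. -/
theorem exists_print (s t q : ℕ) : ∃ c C, ∀ (I : Inst s q) (W L M : ℕ)
    (S₀ : Arrays (Cells s t q)), Bounded M S₀ → I.dim + 3 ≤ W → C * (M + 1) ≤ L →
    Triple (code s t q) W L (nestTime (I.dim + 3) C s) I.regs c (· = S₀)
      (Printed M S₀ (enum (kLoops s) I.regs)) := by
  obtain ⟨b₀, hb⟩ := exists_code_lt s t q
  obtain ⟨c, C, h⟩ := exists_assign (code_injective s t q) (z := s) hb (B := Fin t × Fin s)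
    (D := fun e => inp (e.1.castLE (Nat.le_add_left t q)) e.2)
    (fun e e' h => by
      simp only [Sum.inl.injEq, Prod.mk.injEq] at h
      exact Prod.ext (Fin.castLE_injective _ h.1) h.2)
    (fun e => kReg e.2) (f := fun e S ρ => S (outv e) (ρ (kReg e.2))) (fun _ => .var _ _) (by
      intro e S S' ρ hSS
      rw [show S (outv e) = S' (outv e) from hSS _ (.inr (by simp))])
  refine ⟨nest (s + 1) (kLoops s) c, C, fun I W L M S₀ hS₀ hW hL => ?_⟩
  have hE := I.isEnv_regs
  have hlr := hE.loopRegs_k I.regs_kReg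
  have := triple_nest hW (kLoops s) I.regs hlr (Printed M S₀) (T := C) (c := c)
    (code := code s t q) (L := L) fun m ρ' hm => by
      have hmem : ρ' ∈ enum (kLoops s) I.regs := hm.subset (by simp)
      have hz : ρ' s = 0 := by
        rw [((hE.mem_enum_k I.regs_kReg).1 hmem).2 s fun j => by simp only [kReg]; omega, hE.zero]
      refine h W L M ρ' _ _ hz hL fun S hS => ⟨hS.bdd, fun _ => hS.bdd _ _, fun S' hS' hA => ?_⟩
      have hit := fun e => hA.hit e (by simp)
      simp only [hS.out] at hit
      refine ⟨hS', fun e => (hA.miss_array _ (by simp)).trans (hS.out e), fun e ρ hρ => ?_⟩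
      by_cases hk : ρ (kReg e.2) = ρ' (kReg e.2)
      · rw [hk]; exact hit e
      · rcases List.mem_append.1 hρ with hρ | hρ
        · rw [hA.miss _ _ fun e' _ he => ?_, hS.done e ρ hρ]
          have : e' = e := by
            simp only [Sum.inl.injEq, Prod.mk.injEq] at he
            exact Prod.ext (Fin.castLE_injective _ he.1) he.2
          rw [this]
          exact Ne.symm hk
        · exact absurd (by rw [List.mem_singleton.1 hρ]) hk
  rw [show (kLoops s).length = s by simp [kLoops]] at this
  exact this.mono le_rfl (by rintro _ rfl; exact ⟨hS₀, fun _ => rfl, by simp⟩) fun _ h => h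

/-! ### Initialization of the registers -/

/-- The program adding the contents of the registers in a list to register `r`. -/
def addRegs (r : ℕ) : List ℕ → Prog
  | [] => .skip
  | j :: l => .seq (.instr (.idxOp .add r r j)) (addRegs r l)

theorem run_addRegs {W L r : ℕ} (l : List ℕ) (hr : r ∉ l) (σ : Mem)
    (hW : σ.reg r + (l.map σ.reg).sum ≤ W) :
    Run W L (addRegs r l) σ (l.length + 1) (σ.setReg r (σ.reg r + (l.map σ.reg).sum)) := by
  induction l generalizing σ with
  | nil => simpa [addRegs, Mem.setReg] using Run.skip (W := W) (L := L) σ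
  | cons j l ih =>
    simp only [List.mem_cons, not_or] at hr
    simp only [List.map_cons, List.sum_cons] at hW ⊢
    have hmap : l.map (Function.update σ.reg r (σ.reg r + σ.reg j)) = l.map σ.reg :=
      List.map_congr_left fun i hi => Function.update_of_ne (fun h : i = r => hr.2 (h ▸ hi)) _ _
    have h1 : Run W L (.instr (.idxOp .add r r j)) σ 1 (σ.setReg r (σ.reg r + σ.reg j)) :=
      .instr (.idxOp σ .add r r j (by simp only [IdxOp.eval]; omega))
    have h2 := ih hr.2 (σ.setReg r (σ.reg r + σ.reg j)) (by
      simp only [Mem.setReg, hmap, Function.update_self]; omega)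
    simp only [Mem.setReg, hmap, Function.update_self, Function.update_idem] at h2
    have := Run.seq h1 h2
    rw [add_comm 1] at this
    simpa only [addRegs, List.length_cons, Mem.setReg, add_assoc] using this

theorem exists_init (s q : ℕ) : ∃ c, ∀ (I : Inst s q) (W L : ℕ), I.dim + 3 ≤ W →
    ∃ T σ, T ≤ s + 3 ∧ Run W L c I.input T σ ∧ σ.reg = I.regs ∧ σ.arr = I.input.arr := by
  refine ⟨.seq (.instr (.idxConst (s + 1) 1)) (.seq (.instr (.idxConst (s + 2) 3))
    (addRegs (s + 2) ((List.finRange s).map Fin.val))), fun I W L hW => ?_⟩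
  set σ := (I.input.setReg (s + 1) 1).setReg (s + 2) 3 with hσ
  have hn : ∀ j : Fin s, σ.reg j = I.n j := by
    intro j
    have h1 : (j : ℕ) ≠ s + 1 := by omega
    have h2 : (j : ℕ) ≠ s + 2 := by omega
    simp [hσ, Mem.setReg, h1, h2, Inst.input]
  have hsum : (((List.finRange s).map Fin.val).map σ.reg).sum = I.dim := by
    rw [List.map_map, Inst.dim, Fin.sum_univ_def]
    exact congrArg List.sum (List.map_congr_left fun j _ => hn j)
  have h3 : σ.reg (s + 2) = 3 := by simp [hσ, Mem.setReg]
  have hr := run_addRegs (W := W) (L := L) (r := s + 2) ((List.finRange s).map Fin.val) (by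
    simp only [List.mem_map, not_exists, not_and]
    rintro j _ h
    omega) σ (by rw [hsum, h3]; omega)
  rw [hsum, h3, List.length_map, List.length_finRange] at hr
  refine ⟨_, _, ?_, .seq (.instr (.idxConst _ _ _ (by omega)))
    (.seq (.instr (.idxConst _ _ _ (by omega))) hr), ?_, rfl⟩
  · omega
  · funext r
    simp only [hσ, Mem.setReg, Inst.regs, Inst.input, Function.update_apply]
    split_ifs <;> omega

/-! ### Polynomial bounds -/

/-- The values of `f` are those of a polynomial. -/
def IsPoly (f : ℕ → ℕ) : Prop := ∃ P : Polynomial ℕ, ∀ n, P.eval n = f n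

namespace IsPoly

variable {f g : ℕ → ℕ}

theorem const (c : ℕ) : IsPoly fun _ => c := ⟨.C c, fun n => by simp⟩

theorem id : IsPoly fun n => n := ⟨.X, fun n => by simp⟩

theorem add (hf : IsPoly f) (hg : IsPoly g) : IsPoly fun n => f n + g n := by
  obtain ⟨P, hP⟩ := hf; obtain ⟨Q, hQ⟩ := hg
  exact ⟨P + Q, fun n => by simp [hP, hQ]⟩

theorem mul (hf : IsPoly f) (hg : IsPoly g) : IsPoly fun n => f n * g n := by
  obtain ⟨P, hP⟩ := hf; obtain ⟨Q, hQ⟩ := hg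
  exact ⟨P * Q, fun n => by simp [hP, hQ]⟩

theorem pow (hf : IsPoly f) (k : ℕ) : IsPoly fun n => f n ^ k := by
  obtain ⟨P, hP⟩ := hf
  exact ⟨P ^ k, fun n => by simp [hP]⟩

theorem nestTime (hf : IsPoly f) (hg : IsPoly g) (k : ℕ) :
    IsPoly fun n => nestTime (f n) (g n) k := by
  induction k with
  | zero => exact hg
  | succ k ih => exact (hf.mul (ih.add (.const 2))).add (.const 2)

end IsPoly

/-! ### The main theorem -/

/-- One of the enumerated guesses is optimal among all solutions, so a minimum over the feasible
guesses is a global minimum. -/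
theorem Searched.exists_optimal {rk : ℕ → Prop} (hrk : RankCondition t rk) {I : Inst s q} {M : ℕ}
    {S : Arrays (Cells s t q)} (h : Searched rk I M (enum (gLoops s t q) I.regs) S) :
    ∃ z : ∀ j, Fin (I.n j) → Ty t, Optimal rk I z ∧
      ∀ e (k : Fin (I.n e.2)), S (outv e) k = vec z e.1 e.2 k := by
  obtain ⟨g, hg, hopt⟩ := exists_optimal_cand hrk I
  obtain ⟨ρ, hρ, hρg⟩ := I.exists_mem_enum g hg
  have hc : candAt t I ρ = cand I g := by
    simp only [candAt, hρg]
  rcases h.search with ⟨_, h₂⟩ | ⟨_, ρ₁, _, k₂, _, k₄, k₅⟩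
  · exact absurd (hc ▸ hopt.1) (h₂ ρ hρ)
  · refine ⟨candAt t I ρ₁, ⟨k₂, fun z' hz' => ?_⟩, k₄⟩
    refine (k₅ ρ hρ (hc ▸ hopt.1)).trans ?_
    rw [obj, hc]
    exact hopt.2 z' hz'

theorem stronglyPolySolvable {rk : ℕ → Prop} (hs : 0 < s) (hrk : RankCondition t rk)
    (adm : Inst s q → Prop) : StronglyPolySolvable s t q rk adm := by
  obtain ⟨c₀, h₀⟩ := exists_init s q
  obtain ⟨c₁, C₁, h₁⟩ := exists_count s t q
  obtain ⟨c₂, C₂, h₂⟩ := exists_try hrk s q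
  obtain ⟨c₃, C₃, h₃⟩ := exists_print s t q
  obtain ⟨C₄, h₄⟩ := exists_sumBound s t q
  let K := (gLoops s t q).length
  let f : ℕ → ℕ := fun n => n + 3
  let T : ℕ → ℕ := fun n => s + 3 + nestTime (f n) C₁ 1 + nestTime (f n) (candTime s C₂ (f n)) K +
    nestTime (f n) C₃ s
  -- The partial sums of the objective plus the entries of the input and of the list of positions.
  let M : ℕ → ℕ := fun n => (n + 3) ^ s * (C₄ * (n + 6) + 1) + 1 + (n + 5)
  let B : ℕ → ℕ := fun n => (C₁ + C₂ + C₃) * (M n + 1)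
  have hf : IsPoly f := IsPoly.id.add (.const 3)
  have hT : IsPoly T :=
    (((IsPoly.const (s + 3)).add (hf.nestTime (.const C₁) 1)).add (hf.nestTime
      (((IsPoly.const 2).mul (.const C₂)).add ((IsPoly.const 2).mul (hf.nestTime (.const C₂) s))) K)).add
      (hf.nestTime (.const C₃) s)
  have hM : IsPoly M :=
    (((hf.pow s).mul (((IsPoly.const C₄).mul (IsPoly.id.add (.const 6))).add (.const 1))).add
      (.const 1)).add (IsPoly.id.add (.const 5))
  have hB : IsPoly B := (IsPoly.const (C₁ + C₂ + C₃)).mul (hM.add (.const 1))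
  -- One polynomial dominates the running time, the indices and the bit sizes. T is polynomial
  -- because the number K of guess loops depends only on s, t, q.
  obtain ⟨P, hP⟩ := (hT.add hf).add hB
  refine ⟨.seq c₀ (.seq c₁ (.seq (nest (s + 1) (gLoops s t q) c₂) c₃)), P, ?_⟩
  rintro ⟨I, _⟩
  simp only [hP]
  set W := T I.dim + f I.dim + B I.dim with hWdef
  set L := T I.size + f I.size + B I.size with hLdef
  set m := M I.size with hm
  have hW : I.dim + 3 ≤ W := by simp only [hWdef, f]; omega
  have hL : (C₁ + C₂ + C₃) * (m + 1) ≤ L := by simp only [hLdef, B, ← hm]; omega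
  have hL1 : C₁ * (m + 1) ≤ L := by nlinarith
  have hL2 : C₂ * (m + 1) ≤ L := by nlinarith
  have hL3 : C₃ * (m + 1) ≤ L := by nlinarith
  have hm5 : I.size + 5 ≤ m := Nat.le_add_left _ _
  have hsb : SumBound t I m := h₄ I m (Nat.le_add_right _ _)
  obtain ⟨T₀, σ₀, a₁, a₂, a₃, a₄⟩ := h₀ I W L hW
  -- The working arrays are numbered from (q + t) s on, beyond the input, and start out as zero.
  have hzero : ∀ a k, σ₀.view (code s t q) (.inr a) k = 0 := fun a k => by
    simp only [Mem.view, a₄, code, Sum.elim_inr]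
    refine I.input_arr_eq_zero hs ?_ k
    rw [Nat.add_mul, Nat.add_assoc]
    exact Nat.le_add_right _ _
  have hinit : Counted I m [] (σ₀.view (code s t q)) := by
    refine ⟨fun p j k => by simp only [Mem.view, a₄]; rfl, ?_, hzero _ _, by simp [hzero], by simp⟩
    rintro (e | a) k
    · simp only [Mem.view, a₄]
      exact (I.ht_input_le _ _).trans (by omega)
    · rw [hzero]; simp only [ht_zero]; omega
  have hsearch := triple_nest (one := s + 1) hW (gLoops s t q) I.regs I.loopRegs_g (Searched rk I m)
    fun l ρ hl => h₂ I W L m ρ l (I.isGuessEnv (hl.subset (by simp))) hsb (by omega) hW hL2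
  have htriple : Triple (code s t q) W L _ I.regs _ (Counted I m [])
      fun S' => ∃ S, Searched rk I m (enum (gLoops s t q) I.regs) S ∧
        Printed m S (enum (kLoops s) I.regs) S' :=
    ((h₁ I W L m hm5 hW hL1).mono le_rfl (fun _ h => h)
      fun _ h => h.searched (rk := rk)).seq (hsearch.seq (.of_forall fun S hS =>
        (h₃ I W L m S hS.loaded.bdd hW hL3).mono le_rfl (fun _ h => h) fun S' hS' => ⟨S, hS, hS'⟩))
  obtain ⟨T₁, σ, b₁, b₂, _, S, b₃, b₄⟩ := htriple σ₀ a₃ hinit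
  refine ⟨T₀ + T₁, σ, .seq a₂ b₂, ?_, ?_⟩
  · simp only [T, f, K, hWdef]
    omega
  · obtain ⟨z, hz, hout⟩ := b₃.exists_optimal hrk
    have ho : output I.n t σ = vec z := by
      classical
      funext i j k
      have := b₄.done (i, j) _ (I.isEnv_regs.setK_mem I.regs_kReg
        (Function.update (fun j => ⟨0, I.n_pos j⟩) j k))
      rw [setK_kReg, Function.update_self] at this
      exact this.trans (hout (i, j) k)
    refine ⟨fun i => by rw [ho]; exact isBinary_vec z i, ?_⟩
    rw [ho]
    exact hz.isBest hs hrk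

theorem rankCondition_eq (t : ℕ) : RankCondition t fun r => r = t :=
  ⟨fun _ h => h.le, fun _ _ h h₁ h₂ => le_antisymm h₂ (h ▸ h₁), rfl⟩

theorem rankCondition_le (t : ℕ) : RankCondition t fun r => r ≤ t :=
  ⟨fun _ h => h, fun _ _ _ _ h => h, le_rfl⟩

end BTF

theorem mainTheorem3 (s t q : ℕ) (hs : 0 < s) :
    -- a factorization of the input tensor into `q` outer products is given
    (BTF.StronglyPolySolvable s t q (fun r => r = t) (fun _ => True) ∧
      BTF.StronglyPolySolvable s t q (fun r => r ≤ t) (fun _ => True)) ∧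
    -- the input tensor has rank `q` and a rank factorization is given
    (BTF.StronglyPolySolvable s t q (fun r => r = t) (fun I => BTF.HasRank I.tensor q) ∧
      BTF.StronglyPolySolvable s t q (fun r => r ≤ t) (fun I => BTF.HasRank I.tensor q)) := by
  have h₁ := BTF.rankCondition_eq t
  have h₂ := BTF.rankCondition_le t
  exact ⟨⟨BTF.stronglyPolySolvable hs h₁ _, BTF.stronglyPolySolvable hs h₂ _⟩,
    BTF.stronglyPolySolvable hs h₁ _, BTF.stronglyPolySolvable hs h₂ _⟩
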